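/- Let $k$ be a field of characteristic zero, $n \ge 0$, $R = k[x_1,\dots,x_n]$ with its standard grading, and $\widehat R = k[[x_1,\dots,x_n]]$. Let $\mathscr D = \mathscr D(R,k)$ and $\widehat{\mathscr D} = \mathscr D(\widehat R,k)$ be the rings of $k$-linear differential operators on $R$ and on $\widehat R$, with $\mathscr D \subseteq \widehat{\mathscr D}$ the inclusion extending $R \subseteq \widehat R$ and sending $\partial_i$ to $\partial_i$. Let $R^\tau$ be the right $\mathscr D$-module with underlying group $R$ and action $r\cdot\delta = \tau(\delta)(r)$, where $\tau$ is the standard transposition $\tau(f\,\partial_1^{i_1}\cdots\partial_n^{i_n}) = (-1)^{i_1+\cdots+i_n}\,\partial_1^{i_1}\cdots\partial_n^{i_n} f$; define the right $\widehat{\mathscr D}$-module $\widehat R^\tau$ in the same way. For a left $\mathscr D$-module $M$, let $\widehat M = \widehat R\otimes_R M$, which is a left $\widehat{\mathscr D}$-module in which $\widehat R$ acts by multiplication on the first factor and $\partial_i(\widehat s\otimes m) = \partial_i(\widehat s)\otimes m + \widehat s\otimes \partial_i m$. Let $M$ be a finitely generated graded left $\mathscr D$-module, that is, a finitely generated left $\mathscr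 D$-module with a decomposition $M=\bigoplus_{l\in\mathbb Z} M_l$ such that $R_d\, M_l\subseteq M_{d+l}$ for all $d \ge 0$ and $l \in \mathbb Z$, and $\partial_i M_l\subseteq M_{l-1}$ for all $i$ and $l$. For $j\ge 0$ let $$\iota_j:\ \mathrm{Tor}_j^{\mathscr D}(R^\tau,M)\longrightarrow \mathrm{Tor}_j^{\widehat{\mathscr D}}(\widehat R^\tau,\widehat M)$$ be the natural $k$-linear map induced by $\mathscr D\subseteq\widehat{\mathscr D}$, $R^\tau\subseteq\widehat R^\tau$ and $M\to\widehat M$, $m\mapsto 1\otimes m$: it is the map on homology of $R^\tau\otimes_{\mathscr D}P_\bullet\to\widehat R^\tau\otimes_{\widehat{\mathscr D}}Q_\bullet$ obtained from projective resolutions $P_\bullet\to M$ over $\mathscr D$ and $Q_\bullet\to\widehat M$ over $\widehat{\mathscr D}$ and a $\mathscr D$-linear chain map $P_\bullet\to Q_\bullet$ lifting $M\to\widehat M$. Then: (a) $\iota_j$ is injective for every $j\ge 0$. (b) For every $j\ge 0$ such that $\dim_k \mathrm{Tor}_j^{\mathscr D}(R^\tau,M)<\infty$, the map $\iota_j$ is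 an isomorphism of $k$-vector spaces. -/

import Mathlib

universe u

namespace DMod

noncomputable section

open scoped TensorProduct

set_option linter.unusedSectionVars false

section DiffOp

variable (k : Type u) (A : Type u) [CommRing k] [CommRing A] [Algebra k A]

/-- `IsDiffOp k A m P`: the `k`-linear endomorphism `P` of `A` is a differential operator of
order at most `m` in the sense of Grothendieck. -/
def IsDiffOp : ℕ → Module.End k A → Prop
  | 0, P => ∀ a : A, P * Algebra.lmul k A a - Algebra.lmul k A a * P = 0
  | m + 1, P => ∀ a : A, IsDiffOp m (P * Algebra.lmul k A a - Algebra.lmul k A a * P)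

variable {k A}

lemma IsDiffOp.zero_op (m : ℕ) : IsDiffOp k A m 0 := by
  induction m with
  | zero => intro a; simp
  | succ m ih => intro a; simpa using ih

lemma IsDiffOp.succ {m : ℕ} {P : Module.End k A} (h : IsDiffOp k A m P) :
    IsDiffOp k A (m + 1) P := by
  induction m generalizing P with
  | zero => intro a; rw [h a]; exact IsDiffOp.zero_op 0
  | succ m ih => intro a; exact ih (h a)

lemma IsDiffOp.mono {m m' : ℕ} (hm : m ≤ m') {P : Module.End k A} (h : IsDiffOp k A m P) :
    IsDiffOp k A m' P := by
  induction hm with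
  | refl => exact h
  | step _ ih => exact ih.succ

lemma IsDiffOp.add {m : ℕ} {P Q : Module.End k A} (hP : IsDiffOp k A m P)
    (hQ : IsDiffOp k A m Q) : IsDiffOp k A m (P + Q) := by
  induction m generalizing P Q with
  | zero =>
    intro a
    have h := congrArg₂ (· + ·) (hP a) (hQ a)
    simp only [add_zero] at h
    rw [← h]; noncomm_ring
  | succ m ih =>
    intro a
    have h := ih (hP a) (hQ a)
    convert h using 1
    noncomm_ring

lemma IsDiffOp.lmul (a : A) : IsDiffOp k A 0 (Algebra.lmul k A a) := by
  intro b
  rw [← map_mul, ← map_mul, mul_comm, sub_self]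

lemma IsDiffOp.mul {m m' : ℕ} {P Q : Module.End k A} (hP : IsDiffOp k A m P)
    (hQ : IsDiffOp k A m' Q) : IsDiffOp k A (m + m') (P * Q) := by
  have key : ∀ (P Q : Module.End k A) (a : A),
      P * Q * Algebra.lmul k A a - Algebra.lmul k A a * (P * Q) =
      P * (Q * Algebra.lmul k A a - Algebra.lmul k A a * Q) +
      (P * Algebra.lmul k A a - Algebra.lmul k A a * P) * Q := by
    intro P Q a; simp only [mul_sub, sub_mul, mul_assoc]; abel
  induction hs : m + m' generalizing m m' P Q with
  | zero =>
    obtain ⟨rfl, rfl⟩ : m = 0 ∧ m' = 0 := by omega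
    intro a
    rw [key, hP a, hQ a]; simp
  | succ s ih =>
    intro a
    rw [key]
    refine IsDiffOp.add ?_ ?_
    · cases m' with
      | zero => rw [hQ a, mul_zero]; exact IsDiffOp.zero_op _
      | succ m' => exact ih hP (hQ a) (by omega)
    · cases m with
      | zero => rw [hP a, zero_mul]; exact IsDiffOp.zero_op _
      | succ m => exact ih (hP a) hQ (by omega)

variable (k A) in
/-- The subring of `End_k(A)` formed by the `k`-linear differential operators on `A`. -/
def diffOps : Subring (Module.End k A) where
  carrier := {P | ∃ m, IsDiffOp k A m P}
  mul_mem' := fun ⟨m, hm⟩ ⟨m', hm'⟩ => ⟨m + m', hm.mul hm'⟩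
  add_mem' := fun ⟨m, hm⟩ ⟨m', hm'⟩ =>
    ⟨max m m', (hm.mono (le_max_left _ _)).add (hm'.mono (le_max_right _ _))⟩
  zero_mem' := ⟨0, IsDiffOp.zero_op 0⟩
  one_mem' := ⟨0, by rw [← map_one (Algebra.lmul k A)]; exact IsDiffOp.lmul 1⟩
  neg_mem' := fun {P} ⟨m, hm⟩ => ⟨0 + m, by
    have h : -P = Algebra.lmul k A (-1) * P := by ext a; simp
    rw [h]; exact (IsDiffOp.lmul _).mul hm⟩

variable (k A) in
/-- The ring `𝒟(A, k)` of `k`-linear differential operators on `A`. -/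
def DiffOp : Type u := diffOps k A

instance : Ring (DiffOp k A) := inferInstanceAs (Ring (diffOps k A))

/-- A differential operator as a `k`-linear endomorphism of `A`. -/
def DiffOp.toEnd (P : DiffOp k A) : Module.End k A := P.1

lemma DiffOp.ext {P Q : DiffOp k A} (h : P.toEnd = Q.toEnd) : P = Q := Subtype.ext h

@[simp] lemma DiffOp.toEnd_zero : (0 : DiffOp k A).toEnd = 0 := rfl

@[simp] lemma DiffOp.toEnd_one : (1 : DiffOp k A).toEnd = 1 := rfl

@[simp] lemma DiffOp.toEnd_add (P Q : DiffOp k A) : (P + Q).toEnd = P.toEnd + Q.toEnd := rfl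

@[simp] lemma DiffOp.toEnd_neg (P : DiffOp k A) : (-P).toEnd = -P.toEnd := rfl

@[simp] lemma DiffOp.toEnd_sub (P Q : DiffOp k A) : (P - Q).toEnd = P.toEnd - Q.toEnd := rfl

@[simp] lemma DiffOp.toEnd_mul (P Q : DiffOp k A) : (P * Q).toEnd = P.toEnd * Q.toEnd := rfl

/-- `A` is a left `𝒟(A, k)`-module: operators act on functions. -/
instance : Module (DiffOp k A) A :=
  Module.compHom A
    ({ toFun := DiffOp.toEnd, map_zero' := rfl, map_one' := rfl, map_add' := fun _ _ => rfl,
       map_mul' := fun _ _ => rfl } : DiffOp k A →+* Module.End k A)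

lemma DiffOp.smul_def (P : DiffOp k A) (a : A) : P • a = P.toEnd a := rfl

/-- The operator of multiplication by an element of `A`. -/
def DiffOp.ofFun : A →+* DiffOp k A where
  toFun a := ⟨Algebra.lmul k A a, 0, IsDiffOp.lmul a⟩
  map_one' := DiffOp.ext (map_one (Algebra.lmul k A))
  map_mul' a b := DiffOp.ext (map_mul (Algebra.lmul k A) a b)
  map_zero' := DiffOp.ext (map_zero (Algebra.lmul k A))
  map_add' a b := DiffOp.ext (map_add (Algebra.lmul k A) a b)

/-- A `k`-linear derivation of `A`, as a differential operator. -/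
def DiffOp.ofDer (δ : Derivation k A A) : DiffOp k A :=
  ⟨(δ : A →ₗ[k] A), 1, fun a => by
    have h : (δ : Module.End k A) * Algebra.lmul k A a - Algebra.lmul k A a * (δ : A →ₗ[k] A) =
        Algebra.lmul k A (δ a) := by
      ext b; simp [mul_comm]
    rw [h]; exact IsDiffOp.lmul _⟩

lemma DiffOp.ofFun_apply (a b : A) : (DiffOp.ofFun a : DiffOp k A).toEnd b = a * b := rfl

lemma DiffOp.ofDer_apply (δ : Derivation k A A) (b : A) :
    (DiffOp.ofDer δ : DiffOp k A).toEnd b = δ b := rfl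

end DiffOp

section Monomials

variable {S : Type u} [Monoid S] {n : ℕ}

lemma dpow_aux (d : Fin n → S) (hd : ∀ i j, Commute (d i) (d j)) :
    Pairwise fun i j => ∀ x y : Multiplicative ℕ,
      Commute (powersHom S (d i) x) (powersHom S (d j) y) :=
  fun i j _ x y => by simpa [powersHom_apply] using (hd i j).pow_pow _ _

/-- The monomial `d₁ ^ α₁ ⋯ dₙ ^ αₙ` in pairwise commuting elements `dᵢ`. -/
def dpow (d : Fin n → S) (hd : ∀ i j, Commute (d i) (d j)) (α : Fin n →₀ ℕ) : S :=
  MonoidHom.noncommPiCoprod (N := fun _ : Fin n => Multiplicative ℕ)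
    (fun i => powersHom S (d i))
    (dpow_aux d hd)
    (fun i => Multiplicative.ofAdd (α i))

variable {d : Fin n → S} {hd : ∀ i j, Commute (d i) (d j)}

lemma dpow_zero : dpow d hd 0 = 1 := map_one (MonoidHom.noncommPiCoprod _ _)

lemma dpow_add (α β : Fin n →₀ ℕ) : dpow d hd (α + β) = dpow d hd α * dpow d hd β :=
  map_mul (MonoidHom.noncommPiCoprod _ _) _ _

lemma dpow_single (i : Fin n) : dpow d hd (Finsupp.single i 1) = d i := by
  have h : (fun j => Multiplicative.ofAdd ((Finsupp.single i 1 : Fin n →₀ ℕ) j)) =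
      (Pi.mulSingle i (Multiplicative.ofAdd 1) : Fin n → Multiplicative ℕ) := by
    funext j
    by_cases hj : j = i
    · subst hj; simp
    · simp [hj]
  rw [dpow, h, MonoidHom.noncommPiCoprod_mulSingle]
  simp [powersHom_apply]

lemma dpow_mem {P : Submonoid S} (h : ∀ i, d i ∈ P) (α : Fin n →₀ ℕ) : dpow d hd α ∈ P := by
  induction hs : α.degree generalizing α with
  | zero =>
    obtain rfl := (Finsupp.degree_eq_zero_iff α).1 hs
    rw [dpow_zero]; exact P.one_mem
  | succ s ih =>
    have : α ≠ 0 := by rintro rfl; simp at hs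
    obtain ⟨i, hi⟩ := Finsupp.ne_iff.1 this
    have hle : Finsupp.single i 1 ≤ α := by
      rw [Finsupp.single_le_iff]; simp at hi; omega
    rw [← tsub_add_cancel_of_le hle, dpow_add, dpow_single]
    refine P.mul_mem (ih _ ?_) (h i)
    have := congrArg Finsupp.degree (tsub_add_cancel_of_le hle)
    rw [map_add, Finsupp.degree_single] at this
    omega

end Monomials

/-- Coordinates `x₁, …, xₙ` on a `k`-algebra with commuting dual derivations `∂₁, …, ∂ₙ`, where
a `k`-linear operator is determined by its value at `1` if it commutes with the coordinates. -/
class Coordinates (k A : Type u) [Field k] [CommRing A] [Algebra k A] (n : outParam ℕ) where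
  x : Fin n → A
  der : Fin n → Derivation k A A
  der_comm : ∀ i j a, der i (der j a) = der j (der i a)
  der_x : ∀ i j, der i (x j) = if i = j then 1 else 0
  eq_zero : ∀ P : Module.End k A, (∀ i a, P (x i * a) = x i * P a) → P 1 = 0 → P = 0

lemma factorial_ne {k : Type u} [Field k] [CharZero k] {n : ℕ} (α : Fin n →₀ ℕ) : ((α.prod fun _ e => e.factorial : ℕ) : k) ≠ 0 := by
  rw [Nat.cast_ne_zero, Finsupp.prod]
  exact Finset.prod_ne_zero_iff.2 fun i _ => Nat.factorial_ne_zero _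

lemma factorial_mul {k A : Type u} [Field k] [CharZero k] [CommRing A] [Algebra k A] {n : ℕ}
    (α : Fin n →₀ ℕ) :
    algebraMap k A ((α.prod fun _ e => e.factorial : ℕ) : k)⁻¹ *
      ((α.prod fun _ e => e.factorial : ℕ) : A) = 1 := by
  rw [← map_natCast (algebraMap k A), ← map_mul, inv_mul_cancel₀ (factorial_ne α), map_one]

section Normal

variable {k A : Type u} [Field k] [CommRing A] [Algebra k A] {n : ℕ} [Coordinates k A n]

variable (k A) in
/-- The partial derivative `∂ᵢ` as an element of `𝒟(A, k)`. -/
def pd (i : Fin n) : DiffOp k A := DiffOp.ofDer (Coordinates.der i)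

lemma pd_apply (i : Fin n) (a : A) : (pd k A i).toEnd a = Coordinates.der (k := k) i a := rfl

lemma pd_comm (i j : Fin n) : Commute (pd k A i) (pd k A j) :=
  DiffOp.ext (LinearMap.ext fun a => Coordinates.der_comm i j a)

lemma pd_mul_ofFun (i : Fin n) (a : A) :
    pd k A i * DiffOp.ofFun a =
      DiffOp.ofFun a * pd k A i + DiffOp.ofFun (Coordinates.der (k := k) i a) := by
  refine DiffOp.ext (LinearMap.ext fun b => ?_)
  change Coordinates.der (k := k) i (a * b) = a * Coordinates.der (k := k) i b +
    Coordinates.der (k := k) i a * b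
  simp [mul_comm]

variable (k) in
def xpow (α : Fin n →₀ ℕ) : A := α.prod fun i e => (Coordinates.x k i : A) ^ e

lemma xpow_add (α β : Fin n →₀ ℕ) : xpow k (α + β) = (xpow k α * xpow k β : A) :=
  Finsupp.prod_add_index' (by simp) (fun _ _ _ => pow_add _ _ _)

lemma xpow_single (i : Fin n) : xpow k (Finsupp.single i 1) = (Coordinates.x k i : A) := by
  simp [xpow]

lemma der_xpow (i : Fin n) (β : Fin n →₀ ℕ) :
    Coordinates.der (k := k) i (xpow k β : A) =
      (β i : A) * xpow k (β - Finsupp.single i 1) := by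
  induction hs : β.degree generalizing β with
  | zero =>
    obtain rfl := (Finsupp.degree_eq_zero_iff β).1 hs
    simp [xpow]
  | succ s ih =>
    have : β ≠ 0 := by rintro rfl; simp at hs
    obtain ⟨j, hj⟩ := Finsupp.ne_iff.1 this
    have hle : Finsupp.single j 1 ≤ β := by
      rw [Finsupp.single_le_iff]; simp at hj; omega
    obtain ⟨γ, rfl⟩ := exists_add_of_le hle
    rw [map_add, Finsupp.degree_single] at hs
    rw [xpow_add, Derivation.leibniz, ih γ (by omega), xpow_single, Coordinates.der_x]
    by_cases hij : i = j
    · subst hij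
      by_cases hγ : γ i = 0
      · simp [hγ]
      · have h2 : Finsupp.single i 1 ≤ γ := by
          rw [Finsupp.single_le_iff]; omega
        obtain ⟨δ, rfl⟩ := exists_add_of_le h2
        simp [xpow_add, xpow_single]
        ring
    · by_cases hγ : γ i = 0
      · simp [hγ, hij]
      · have h2 : Finsupp.single i 1 ≤ γ := by
          rw [Finsupp.single_le_iff]; omega
        obtain ⟨δ, rfl⟩ := exists_add_of_le h2
        rw [add_left_comm]
        simp [xpow_add, xpow_single, hij]
        ring

variable (k A) in
/-- The operator `∂ ^ α`. -/
def pdPow (α : Fin n →₀ ℕ) : DiffOp k A := dpow (pd k A) pd_comm α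

lemma pdPow_xpow (α β : Fin n →₀ ℕ) (h : β.degree ≤ α.degree) :
    (pdPow k A α).toEnd (xpow k β) = if α = β then ((α.prod fun _ e => e.factorial : ℕ) : A) else 0 := by
  induction hs : α.degree generalizing α β with
  | zero =>
    obtain rfl := (Finsupp.degree_eq_zero_iff α).1 hs
    obtain rfl := (Finsupp.degree_eq_zero_iff β).1 (by omega)
    simp [pdPow, dpow_zero, xpow]
  | succ s ih =>
    have : α ≠ 0 := by rintro rfl; simp at hs
    obtain ⟨j, hj⟩ := Finsupp.ne_iff.1 this
    have hle : Finsupp.single j 1 ≤ α := by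
      rw [Finsupp.single_le_iff]; simp at hj; omega
    obtain ⟨γ, rfl⟩ := exists_add_of_le hle
    have hd : γ.degree = s := by
      rw [map_add, Finsupp.degree_single] at hs; omega
    have e : (pdPow k A (Finsupp.single j 1 + γ)).toEnd (xpow k β) =
        (pdPow k A γ).toEnd (Coordinates.der (k := k) j (xpow k β)) := by
      rw [add_comm, pdPow, dpow_add, dpow_single]; rfl
    rw [e, der_xpow, ← nsmul_eq_mul, map_nsmul]
    by_cases hβ : β j = 0
    · rw [hβ, zero_smul, if_neg]
      rintro rfl
      simp at hβ
    · have h2 : Finsupp.single j 1 ≤ β := by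
          rw [Finsupp.single_le_iff]; omega
      obtain ⟨δ, rfl⟩ := exists_add_of_le h2
      rw [map_add, map_add] at h
      rw [add_tsub_cancel_left, ih γ δ (by omega) hd]
      by_cases hγδ : γ = δ
      · subst hγδ
        simp only [if_true]
        rw [nsmul_eq_mul, ← Nat.cast_mul]
        congr 1
        rw [Finsupp.prod_fintype _ _ (by simp), Finsupp.prod_fintype _ _ (by simp),
          ← Finset.mul_prod_erase _ _ (Finset.mem_univ j),
          ← Finset.mul_prod_erase _ _ (Finset.mem_univ j), ← mul_assoc]
        congr 1
        · simp [add_comm 1, Nat.factorial_succ]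
        · refine Finset.prod_congr rfl fun i hi => ?_
          simp [Finset.ne_of_mem_erase hi]
      · simp [hγδ]

section Sum

variable {S : Type u} [Ring S]

/-- The sum `∑ φ(f_α) d ^ α`. -/
def normalSum (φ : A →+* S) (d : Fin n → S) (hd : ∀ i j, Commute (d i) (d j)) :
    ((Fin n →₀ ℕ) →₀ A) →+ S :=
  Finsupp.liftAddHom fun α => (AddMonoidHom.mulRight (dpow d hd α)).comp φ.toAddMonoidHom

lemma normalSum_single (φ : A →+* S) (d : Fin n → S) (hd : ∀ i j, Commute (d i) (d j))
    (α : Fin n →₀ ℕ) (a : A) :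
    normalSum φ d hd (Finsupp.single α a) = φ a * dpow d hd α := by
  simp [normalSum]

end Sum

variable (k A) in
def normalD : ((Fin n →₀ ℕ) →₀ A) →+ DiffOp k A :=
  normalSum DiffOp.ofFun (pd k A) pd_comm

lemma normalD_apply (f : (Fin n →₀ ℕ) →₀ A) (b : A) :
    (normalD k A f).toEnd b = f.sum fun α a => a * (pdPow k A α).toEnd b := by
  induction f using Finsupp.induction_linear with
  | zero => simp
  | add f g hf hg =>
    rw [map_add, Finsupp.sum_add_index' (by simp) (by intros; ring), ← hf, ← hg]; rfl
  | single α a =>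
    rw [normalD, normalSum_single, Finsupp.sum_single_index (by simp)]; rfl

lemma IsDiffOp.sum_mem {ι : Type*} {m : ℕ} (s : Finset ι) {P : ι → DiffOp k A}
    (h : ∀ i ∈ s, IsDiffOp k A m (P i).toEnd) : IsDiffOp k A m (∑ i ∈ s, P i).toEnd := by
  induction s using Finset.cons_induction with
  | empty => exact IsDiffOp.zero_op _
  | cons a s ha ih =>
    rw [Finset.sum_cons]
    exact (h a (by simp)).add (ih fun i hi => h i (by simp [hi]))

lemma pdPow_order (α : Fin n →₀ ℕ) : IsDiffOp k A α.degree (pdPow k A α).toEnd := by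
  induction hs : α.degree generalizing α with
  | zero =>
    obtain rfl := (Finsupp.degree_eq_zero_iff α).1 hs
    rw [pdPow, dpow_zero]
    have := IsDiffOp.lmul (k := k) (1 : A)
    rwa [map_one] at this
  | succ s ih =>
    have : α ≠ 0 := by rintro rfl; simp at hs
    obtain ⟨i, hi⟩ := Finsupp.ne_iff.1 this
    have hle : Finsupp.single i 1 ≤ α := by
      rw [Finsupp.single_le_iff]; simp at hi; omega
    obtain ⟨γ, rfl⟩ := exists_add_of_le hle
    rw [map_add, Finsupp.degree_single] at hs
    rw [add_comm s 1, pdPow, dpow_add, dpow_single, DiffOp.toEnd_mul]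
    refine IsDiffOp.mul (m := 1) ?_ (ih γ (by omega))
    intro a
    have h : (pd k A i).toEnd * Algebra.lmul k A a - Algebra.lmul k A a * (pd k A i).toEnd =
        Algebra.lmul k A (Coordinates.der (k := k) i a) := by
      ext b; simp [pd_apply, mul_comm]
    rw [h]; exact IsDiffOp.lmul _

lemma eq_zero_of_xpow (m : ℕ) (P : Module.End k A) (hP : IsDiffOp k A m P)
    (h : ∀ α : Fin n →₀ ℕ, α.degree < m + 1 → P (xpow k α) = 0) : P = 0 := by
  have h1 : P 1 = 0 := by simpa [xpow] using h 0 (by simp)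
  induction m generalizing P with
  | zero =>
    refine Coordinates.eq_zero P (fun i a => ?_) h1
    have := LinearMap.congr_fun (hP (Coordinates.x k i)) a
    simpa [sub_eq_zero] using this
  | succ m ih =>
    refine Coordinates.eq_zero P (fun i a => ?_) h1
    have hx : ∀ α : Fin n →₀ ℕ, α.degree < m + 1 →
        (P * Algebra.lmul k A (Coordinates.x k i) -
          Algebra.lmul k A (Coordinates.x k i) * P) (xpow k α) = 0 := by
      intro α hα
      have e1 := h α (by omega)
      have e2 := h (Finsupp.single i 1 + α) (by rw [map_add, Finsupp.degree_single]; omega)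
      rw [xpow_add, xpow_single] at e2
      simp [e1, e2]
    have := ih _ (hP (Coordinates.x k i)) hx (by simpa [xpow] using hx 0 (by simp))
    have := LinearMap.congr_fun this a
    simpa [sub_eq_zero] using this

variable [CharZero k]

lemma normalD_injective : Function.Injective (normalD k A) := by
  rw [injective_iff_map_eq_zero]
  intro f hf
  have key : ∀ s, ∀ α : Fin n →₀ ℕ, α.degree = s → f α = 0 := by
    intro s
    induction s using Nat.strong_induction_on with
    | _ s ih =>
      intro α hα
      have h : (normalD k A f).toEnd (xpow k α) = 0 := by rw [hf]; rfl
      rw [normalD_apply, Finsupp.sum, Finset.sum_eq_single α] at h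
      · rw [pdPow_xpow _ _ le_rfl, if_pos rfl] at h
        rw [← one_mul (f α), ← factorial_mul (k := k) α, mul_assoc, mul_comm _ (f α), h, mul_zero]
      · intro β _ hβ
        by_cases hlt : β.degree < s
        · rw [ih _ hlt β rfl, zero_mul]
        · rw [pdPow_xpow _ _ (by omega), if_neg hβ, mul_zero]
      · intro hα'
        rw [Finsupp.notMem_support_iff.1 hα', zero_mul]
  ext α
  exact key _ α rfl

lemma exists_normal_agree (P : Module.End k A) (m : ℕ) :
    ∃ f, IsDiffOp k A (m - 1) (normalD k A f).toEnd ∧ ∀ α : Fin n →₀ ℕ, α.degree < m → (normalD k A f).toEnd (xpow k α) = P (xpow k α) := by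
  induction m with
  | zero => exact ⟨0, by rw [map_zero]; exact IsDiffOp.zero_op _, fun _ h => by omega⟩
  | succ m ih =>
    obtain ⟨f, hford, hf⟩ := ih
    have hfin : Set.Finite {α : Fin n →₀ ℕ | α.degree = m} := by
      refine (Finset.finite_toSet (Finset.finsuppAntidiag Finset.univ m)).subset fun α hα => ?_
      simp only [Finset.mem_coe, Finset.mem_finsuppAntidiag]
      exact ⟨by rw [← hα, Finsupp.degree_eq_sum], Finset.subset_univ _⟩
    let c : (Fin n →₀ ℕ) → A := fun α =>
      algebraMap k A ((α.prod fun _ e => e.factorial : ℕ) : k)⁻¹ *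
        (P (xpow k α) - (normalD k A f).toEnd (xpow k α))
    let g : (Fin n →₀ ℕ) →₀ A := ∑ α ∈ hfin.toFinset, Finsupp.single α (c α)
    have hg : ∀ β : Fin n →₀ ℕ, (normalD k A g).toEnd (xpow k β) =
        ∑ α ∈ hfin.toFinset, c α * (pdPow k A α).toEnd (xpow k β) := by
      intro β
      rw [normalD_apply, ← Finsupp.sum_finsetSum_index (by simp) (by intros; ring)]
      refine Finset.sum_congr rfl fun α _ => ?_
      rw [Finsupp.sum_single_index (by simp)]
    refine ⟨f + g, ?_, fun β hβ => ?_⟩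
    · rw [map_add]
      refine IsDiffOp.add (hford.mono (by omega)) ?_
      rw [map_sum]
      refine IsDiffOp.sum_mem _ fun α hα => ?_
      have hα' : α.degree = m := by simpa using hα
      rw [normalD, normalSum_single, Nat.add_sub_cancel, ← hα', ← zero_add α.degree]
      exact (IsDiffOp.lmul _).mul (pdPow_order α)
    have e : (normalD k A (f + g)).toEnd (xpow k β) =
        (normalD k A f).toEnd (xpow k β) + (normalD k A g).toEnd (xpow k β) := by
      rw [map_add]; rfl
    rw [e, hg]
    by_cases hm : β.degree = m
    · rw [Finset.sum_eq_single β]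
      · rw [pdPow_xpow _ _ le_rfl, if_pos rfl, mul_right_comm, factorial_mul]
        ring
      · intro α hα hαβ
        have : α.degree = m := by simpa using hα
        rw [pdPow_xpow _ _ (by omega), if_neg hαβ, mul_zero]
      · intro h; simp [hm] at h
    · rw [Finset.sum_eq_zero, add_zero, hf β (by omega)]
      intro α hα
      have : α.degree = m := by simpa using hα
      rw [pdPow_xpow _ _ (by omega), if_neg, mul_zero]
      rintro rfl; exact hm this

lemma normalD_surjective : Function.Surjective (normalD k A) := by
  intro P
  obtain ⟨m, hm⟩ := P.2
  obtain ⟨f, hford, hf⟩ := exists_normal_agree P.toEnd (m + 1)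
  refine ⟨f, ?_⟩
  rw [← sub_eq_zero]
  refine DiffOp.ext (eq_zero_of_xpow m (normalD k A f - P).toEnd ?_ fun α hα => ?_)
  · have h := IsDiffOp.add hford ((IsDiffOp.lmul (-1 : A)).mul hm |>.mono (by omega))
    rw [Nat.add_sub_cancel] at h
    have e : (normalD k A f - P).toEnd = (normalD k A f).toEnd + Algebra.lmul k A (-1) * P.toEnd := by
      ext b
      simp [sub_eq_add_neg]
    rwa [e]
  · change (normalD k A f).toEnd (xpow k α) - P.toEnd (xpow k α) = 0
    rw [hf α hα, sub_self]

/-- The coefficients of a differential operator: `P = ∑ f_α ∂ ^ α`. -/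
def normalEquiv : ((Fin n →₀ ℕ) →₀ A) ≃+ DiffOp k A :=
  AddEquiv.ofBijective (normalD k A) ⟨normalD_injective, normalD_surjective⟩

lemma normalEquiv_single (α : Fin n →₀ ℕ) (a : A) :
    normalEquiv (Finsupp.single α a) = DiffOp.ofFun a * pdPow k A α :=
  normalSum_single _ _ _ _ _

/-- `𝒟(A, k)` is generated by `A` and the `∂ᵢ`. -/
lemma DiffOp.induction_gen {p : DiffOp k A → Prop} (hf : ∀ a : A, p (DiffOp.ofFun a))
    (hd : ∀ i, p (pd k A i)) (hadd : ∀ P Q, p P → p Q → p (P + Q))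
    (hmul : ∀ P Q, p P → p Q → p (P * Q)) (P : DiffOp k A) : p P := by
  obtain ⟨f, rfl⟩ := normalEquiv.surjective P
  have h1 : p 1 := by simpa using hf 1
  let T : Submonoid (DiffOp k A) :=
    { carrier := {P | p P}, one_mem' := h1, mul_mem' := fun h h' => hmul _ _ h h' }
  induction f using Finsupp.induction_linear with
  | zero => simpa using hf 0
  | add f g h h' => rw [map_add]; exact hadd _ _ h h'
  | single α a =>
    rw [normalEquiv_single]
    exact hmul _ _ (hf a) (dpow_mem (P := T) hd α)

section Lift

variable {S : Type u} [Ring S] (φ : A →+* S) (d : Fin n → S)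
  (hd : ∀ i j, Commute (d i) (d j))

/-- Auxiliary additive version of `DiffOp.lift`. -/
def liftAux : DiffOp k A →+ S := (normalSum φ d hd).comp normalEquiv.symm.toAddMonoidHom

lemma liftAux_single (α : Fin n →₀ ℕ) (a : A) :
    liftAux φ d hd (DiffOp.ofFun a * pdPow k A α) = φ a * dpow d hd α := by
  rw [← normalEquiv_single]
  simp [liftAux, normalSum_single]

lemma liftAux_ofFun (a : A) : liftAux φ d hd (DiffOp.ofFun a : DiffOp k A) = φ a := by
  have := liftAux_single (k := k) φ d hd 0 a
  simpa [pdPow, dpow_zero] using this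

lemma liftAux_pd (i : Fin n) : liftAux φ d hd (pd k A i) = d i := by
  have := liftAux_single (k := k) φ d hd (Finsupp.single i 1) 1
  simpa [pdPow, dpow_single] using this

lemma liftAux_mul
    (hφ : ∀ i a, d i * φ a = φ a * d i + φ (Coordinates.der (k := k) i a)) (P Q : DiffOp k A) :
    liftAux φ d hd (P * Q) = liftAux φ d hd P * liftAux φ d hd Q := by
  revert Q
  refine DiffOp.induction_gen
    (p := fun P => ∀ Q, liftAux φ d hd (P * Q) = liftAux φ d hd P * liftAux φ d hd Q)
    ?_ ?_ ?_ ?_ P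
  · intro a Q
    obtain ⟨f, rfl⟩ := normalEquiv.surjective Q
    induction f using Finsupp.induction_linear with
    | zero => simp
    | add f g h h' => rw [map_add, mul_add, map_add, map_add, mul_add, h, h']
    | single α b =>
      rw [normalEquiv_single, ← mul_assoc, ← map_mul, liftAux_single, liftAux_single,
        liftAux_ofFun, map_mul, mul_assoc]
  · intro i Q
    obtain ⟨f, rfl⟩ := normalEquiv.surjective Q
    induction f using Finsupp.induction_linear with
    | zero => simp
    | add f g h h' => rw [map_add, mul_add, map_add, map_add, mul_add, h, h']
    | single α b =>
      have e : pd k A i * pdPow k A α = pdPow k A (Finsupp.single i 1 + α) := by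
        rw [pdPow, pdPow, dpow_add, dpow_single]
      rw [normalEquiv_single, ← mul_assoc, pd_mul_ofFun, add_mul, mul_assoc, e, map_add,
        liftAux_single, liftAux_single, liftAux_single, liftAux_pd, dpow_add, dpow_single,
        ← mul_assoc, ← mul_assoc, hφ, add_mul]
  · intro P P' h h' Q
    rw [add_mul, map_add, map_add, add_mul, h, h']
  · intro P P' h h' Q
    rw [mul_assoc, h, h', h, mul_assoc]

variable (hφ : ∀ i a, d i * φ a = φ a * d i + φ (Coordinates.der (k := k) i a))

/-- A ring homomorphism out of `𝒟(A, k)` is the same as a ring homomorphism `φ` out of `A`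
together with pairwise commuting elements `dᵢ` such that `dᵢ φ(a) - φ(a) dᵢ = φ(∂ᵢ a)`. -/
def DiffOp.lift : DiffOp k A →+* S :=
  { liftAux φ d hd with
    map_one' := by
      have := liftAux_ofFun (k := k) φ d hd 1
      simpa using this
    map_mul' := liftAux_mul φ d hd hφ }

lemma DiffOp.lift_ofFun (a : A) : DiffOp.lift φ d hd hφ (DiffOp.ofFun a : DiffOp k A) = φ a :=
  liftAux_ofFun φ d hd a

lemma DiffOp.lift_pd (i : Fin n) : DiffOp.lift φ d hd hφ (pd k A i) = d i :=
  liftAux_pd φ d hd i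

end Lift

end Normal

section Rings

variable (k : Type u) [Field k] (n : ℕ)

/-- `R = k[x₁, …, xₙ]`. -/
abbrev Poly : Type u := MvPolynomial (Fin n) k

/-- `R̂ = k[[x₁, …, xₙ]]`. -/
abbrev Series : Type u := MvPowerSeries (Fin n) k

lemma poly_eq_zero (P : Module.End k (Poly k n))
    (h : ∀ i a, P (MvPolynomial.X i * a) = MvPolynomial.X i * P a) (h1 : P 1 = 0) : P = 0 := by
  refine LinearMap.ext fun f => ?_
  induction f using MvPolynomial.induction_on with
  | C a => rw [MvPolynomial.C_eq_smul_one, map_smul, h1, smul_zero]; rfl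
  | add p q hp hq => rw [map_add, hp, hq]; simp
  | mul_X p i hp => rw [mul_comm, h, hp]; simp

lemma series_split (f : Series k n) : ∃ g : Fin n → Series k n,
    f = MvPowerSeries.C (MvPowerSeries.coeff 0 f) + ∑ i, MvPowerSeries.X i * g i := by
  classical
  let g : Fin n → Series k n := fun i d =>
    if ∀ j, j < i → d j = 0 then MvPowerSeries.coeff (d + Finsupp.single i 1) f else 0
  have hg : ∀ i d, MvPowerSeries.coeff d (g i) =
      if ∀ j, j < i → d j = 0 then MvPowerSeries.coeff (d + Finsupp.single i 1) f else 0 :=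
    fun i d => rfl
  refine ⟨g, ?_⟩
  ext d
  have hc : ∀ (i : Fin n) (g : Series k n), MvPowerSeries.coeff d (MvPowerSeries.X i * g) =
      if d i ≠ 0 then MvPowerSeries.coeff (d - Finsupp.single i 1) g else 0 := by
    intro i g
    rw [MvPowerSeries.X_def, MvPowerSeries.coeff_monomial_mul]
    simp only [Finsupp.single_le_iff, one_mul, Nat.one_le_iff_ne_zero]
  rw [map_add, map_sum, MvPowerSeries.coeff_C]
  simp only [hc]
  clear_value g
  by_cases hd : d = 0
  · subst hd; simp
  · rw [if_neg hd, zero_add]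
    have hne : (Finset.univ.filter fun i => d i ≠ 0).Nonempty := by
      obtain ⟨i, hi⟩ := Finsupp.ne_iff.1 hd
      exact ⟨i, by simpa using hi⟩
    set m := (Finset.univ.filter fun i => d i ≠ 0).min' hne with hm
    have hm1 : d m ≠ 0 := by
      have := Finset.min'_mem _ hne
      simpa using this
    have hm2 : ∀ j, j < m → d j = 0 := by
      intro j hj
      by_contra hj'
      have := Finset.min'_le (Finset.univ.filter fun i => d i ≠ 0) j (by simpa using hj')
      exact absurd hj (not_lt.2 this)
    have hle : Finsupp.single m 1 ≤ d := by
      rw [Finsupp.single_le_iff]; omega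
    rw [Finset.sum_eq_single m]
    · rw [if_pos hm1]
      rw [hg, if_pos, tsub_add_cancel_of_le hle]
      intro j hj
      simp [hm2 j hj]
    · intro i _ him
      by_cases hi : d i ≠ 0
      · rw [if_pos hi]
        rw [hg, if_neg]
        intro h
        have hlt : m < i := lt_of_le_of_ne
          (Finset.min'_le (Finset.univ.filter fun i => d i ≠ 0) i (by simpa using hi)) (Ne.symm him)
        have := h m hlt
        simp [hlt.ne'] at this
        exact hm1 this
      · rw [if_neg hi]
    · simp

lemma series_eq_zero (P : Module.End k (Series k n))
    (h : ∀ i a, P (MvPowerSeries.X i * a) = MvPowerSeries.X i * P a) (h1 : P 1 = 0) : P = 0 := by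
  have key : ∀ m, ∀ (f : Series k n) (d : Fin n →₀ ℕ), d.degree < m →
      MvPowerSeries.coeff d (P f) = 0 := by
    intro m
    induction m with
    | zero => intro _ _ h; omega
    | succ m ih =>
      intro f d hd
      obtain ⟨g, hg⟩ := series_split k n f
      have hC : P (MvPowerSeries.C (MvPowerSeries.coeff 0 f)) = 0 := by
        have : (MvPowerSeries.C (MvPowerSeries.coeff 0 f) : Series k n) =
            (MvPowerSeries.coeff 0 f) • 1 := by
          rw [MvPowerSeries.smul_eq_C_mul, mul_one]
        rw [this, map_smul, h1, smul_zero]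
      rw [hg, map_add, hC, zero_add, map_sum, map_sum]
      refine Finset.sum_eq_zero fun i _ => ?_
      rw [h, MvPowerSeries.X_def, MvPowerSeries.coeff_monomial_mul]
      split_ifs with hle
      · rw [ih, mul_zero]
        have := congrArg Finsupp.degree (tsub_add_cancel_of_le hle)
        rw [map_add, Finsupp.degree_single] at this
        omega
      · rfl
  ext f d
  exact key _ f d (Nat.lt_succ_self _)

instance polyCoordinates : Coordinates k (Poly k n) n where
  x := MvPolynomial.X
  der := MvPolynomial.pderiv
  der_comm i j a := by
    induction a using MvPolynomial.induction_on with
    | C a => simp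
    | add p q hp hq => simp [hp, hq]
    | mul_X p l hp =>
      simp only [Derivation.leibniz, smul_eq_mul, map_add, hp, MvPolynomial.pderiv_X]
      have hs : ∀ a b : Fin n, MvPolynomial.pderiv a
          (Pi.single (M := fun _ => MvPolynomial (Fin n) k) b 1 l) = 0 := by
        intro a b
        rw [Pi.single_apply]; split_ifs <;> simp
      rw [hs, hs]
      ring
  der_x i j := by
    simp [MvPolynomial.pderiv_X, Pi.single_apply, eq_comm]
  eq_zero := poly_eq_zero k n

instance seriesCoordinates : Coordinates k (Series k n) n where
  x := MvPowerSeries.X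
  der := MvPowerSeries.pderiv k
  der_comm i j a := by
    ext d
    simp only [MvPowerSeries.coeff_pderiv]
    by_cases h : i = j
    · subst h; rfl
    · rw [add_right_comm]
      simp [h, Ne.symm h]
      ring
  der_x i j := by
    simp [MvPowerSeries.pderiv_X, eq_comm, Pi.single_apply]
  eq_zero := series_eq_zero k n

/-- `𝒟 = 𝒟(R, k)`. -/
abbrev D : Type u := DiffOp k (Poly k n)

/-- `𝒟̂ = 𝒟(R̂, k)`. -/
abbrev DHat : Type u := DiffOp k (Series k n)

variable [CharZero k]

/-- The inclusion `𝒟 ⊆ 𝒟̂`: it extends `R ⊆ R̂` and sends `∂ᵢ` to `∂ᵢ`. -/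
def toHat : D k n →+* DHat k n :=
  DiffOp.lift (DiffOp.ofFun.comp MvPolynomial.coeToMvPowerSeries.ringHom)
    (pd k (Series k n)) pd_comm
    (fun i a => by
      simp only [RingHom.comp_apply, pd_mul_ofFun]
      congr 2
      exact MvPowerSeries.pderiv_coe a)

end Rings

instance DiffOp.smulCommClass {k A : Type u} [CommRing k] [CommRing A] [Algebra k A] :
    SMulCommClass k (DiffOp k A) A :=
  ⟨fun c P a => (map_smul P.toEnd c a).symm⟩

section Transposition

variable {k A : Type u} [Field k] [CharZero k] [CommRing A] [Algebra k A] {n : ℕ}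
  [Coordinates k A n]

/-- The standard transposition `τ`, with `τ(f ∂ ^ α) = (-1) ^ |α| ∂ ^ α f`, as an anti-homomorphism
of `𝒟(A, k)`: it fixes `A` and sends `∂ᵢ` to `-∂ᵢ`. -/
def tau : DiffOp k A →+* (DiffOp k A)ᵐᵒᵖ :=
  DiffOp.lift ((DiffOp.ofFun (k := k) (A := A)).toOpposite
      (fun a b => by rw [commute_iff_eq, ← map_mul, mul_comm, map_mul]))
    (fun i => MulOpposite.op (-pd k A i))
    (fun i j => by
      exact congrArg MulOpposite.op ((pd_comm (k := k) (A := A) j i).neg_left.neg_right).eq)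
    (fun i a => by
      refine congrArg MulOpposite.op ?_
      have h := pd_mul_ofFun (k := k) i a
      have aux : ∀ {S : Type u} [Ring S] (p f g : S), p * f = f * p + g → f * -p = -p * f + g := by
        intro S _ p f g h
        rw [mul_neg, neg_mul, h]; abel
      exact aux _ _ _ h)

lemma tau_normal (f : A) (α : Fin n →₀ ℕ) :
    (tau (DiffOp.ofFun f * pdPow k A α)).unop =
      (-1) ^ α.degree * (pdPow k A α * DiffOp.ofFun f) := by
  have hp : (tau (pdPow k A α)).unop = (-1) ^ α.degree * pdPow k A α := by
    induction hs : α.degree generalizing α with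
    | zero =>
      obtain rfl := (Finsupp.degree_eq_zero_iff α).1 hs
      simp [pdPow, dpow_zero]
    | succ s ih =>
      have : α ≠ 0 := by rintro rfl; simp at hs
      obtain ⟨i, hi⟩ := Finsupp.ne_iff.1 this
      have hle : Finsupp.single i 1 ≤ α := by
        rw [Finsupp.single_le_iff]; simp at hi; omega
      obtain ⟨γ, rfl⟩ := exists_add_of_le hle
      rw [map_add, Finsupp.degree_single] at hs
      have e : pdPow k A (Finsupp.single i 1 + γ) = pd k A i * pdPow k A γ := by
        rw [pdPow, pdPow, dpow_add, dpow_single]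
      have e' : pdPow k A (Finsupp.single i 1 + γ) = pdPow k A γ * pd k A i := by
        rw [add_comm, pdPow, pdPow, dpow_add, dpow_single]
      have ht : tau (pd k A i) = MulOpposite.op (-pd k A i) := DiffOp.lift_pd _ _ _ _ i
      rw [e, map_mul, MulOpposite.unop_mul, ih γ (by omega), ht, ← e, e', MulOpposite.unop_op,
        pow_succ]
      have aux : ∀ {S : Type u} [Ring S] (p f g : S), g * f * -p = g * -1 * (f * p) := by
        intro S _ p f g; noncomm_ring
      exact aux _ _ _
  have hf : tau (DiffOp.ofFun f : DiffOp k A) = MulOpposite.op (DiffOp.ofFun f) :=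
    DiffOp.lift_ofFun _ _ _ _ f
  rw [map_mul, MulOpposite.unop_mul, hp, hf, MulOpposite.unop_op, mul_assoc]

/-- `τ` as a ring homomorphism out of the opposite ring. -/
def tauOp : (DiffOp k A)ᵐᵒᵖ →+* DiffOp k A where
  toFun P := (tau P.unop).unop
  map_one' := by simp
  map_mul' P Q := by simp
  map_zero' := by simp
  map_add' P Q := by simp

/-- The transpose `M^τ` of a left `𝒟(A, k)`-module `M`: the same abelian group, with the right
action `m · P = τ(P) m`. Right modules are modules over the opposite ring. -/
def Transpose (M : Type u) : Type u := M

variable {M : Type u}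

instance [AddCommGroup M] : AddCommGroup (Transpose M) := inferInstanceAs (AddCommGroup M)

instance [AddCommGroup M] [Module k M] : Module k (Transpose M) := inferInstanceAs (Module k M)

instance transposeModule [AddCommGroup M] [Module (DiffOp k A) M] :
    Module (DiffOp k A)ᵐᵒᵖ (Transpose M) :=
  Module.compHom M (tauOp (k := k) (A := A))

instance [AddCommGroup M] [Module k M] [Module (DiffOp k A) M] [SMulCommClass k (DiffOp k A) M] :
    SMulCommClass k (DiffOp k A)ᵐᵒᵖ (Transpose M) :=
  ⟨fun c P m => smul_comm c (tauOp P) (show M from m)⟩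

end Transposition

section Completion

variable (k : Type u) [Field k] (n : ℕ)

variable (M : Type u) [AddCommGroup M] [Module (D k n) M]

/-- A `𝒟`-module regarded as an `R`-module by restriction of scalars. -/
abbrev asPolyModule : Module (Poly k n) M :=
  Module.compHom M (DiffOp.ofFun : Poly k n →+* D k n)

attribute [local instance] asPolyModule

/-- The completion `M̂ = R̂ ⊗_R M` of a `𝒟`-module `M`. -/
def Completion : Type u := Series k n ⊗[Poly k n] M

instance : AddCommGroup (Completion k n M) :=
  inferInstanceAs (AddCommGroup (Series k n ⊗[Poly k n] M))

instance : Module (Series k n) (Completion k n M) :=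
  inferInstanceAs (Module (Series k n) (Series k n ⊗[Poly k n] M))

variable {M} in
/-- The pure tensor `s ⊗ m` in `M̂`. -/
def Completion.tmul (s : Series k n) (m : M) : Completion k n M :=
  TensorProduct.tmul (Poly k n) s m

variable {M}

lemma Completion.tmul_add (s : Series k n) (m m' : M) :
    Completion.tmul k n s (m + m') = Completion.tmul k n s m + Completion.tmul k n s m' :=
  TensorProduct.tmul_add (R := Poly k n) (N := M) s m m'

lemma Completion.add_tmul (s s' : Series k n) (m : M) :
    Completion.tmul k n (s + s') m = Completion.tmul k n s m + Completion.tmul k n s' m :=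
  TensorProduct.add_tmul (R := Poly k n) (N := M) s s' m

lemma Completion.tmul_ofFun (s : Series k n) (r : Poly k n) (m : M) :
    Completion.tmul k n s ((DiffOp.ofFun r : D k n) • m) =
      Completion.tmul k n ((r : Series k n) * s) m :=
  (TensorProduct.smul_tmul (R := Poly k n) (N := M) r s m).symm

variable (M) in
/-- The operator `∂ᵢ` on `M̂`: `∂ᵢ (s ⊗ m) = ∂ᵢ(s) ⊗ m + s ⊗ ∂ᵢ m`. -/
def Completion.del (i : Fin n) : AddMonoid.End (Completion k n M) :=
  TensorProduct.liftAddHom (R := Poly k n) (M := Series k n) (N := M)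
    (AddMonoidHom.mk' (fun s => AddMonoidHom.mk' (fun m : M =>
        Completion.tmul k n (MvPowerSeries.pderiv k i s) m +
          Completion.tmul k n s (pd k (Poly k n) i • m))
        (fun m m' => by
          rw [smul_add, Completion.tmul_add, Completion.tmul_add]; abel))
      (fun s s' => by
        refine AddMonoidHom.ext fun m => ?_
        change Completion.tmul k n (MvPowerSeries.pderiv k i (s + s')) m +
          Completion.tmul k n (s + s') (pd k (Poly k n) i • m) = (_ + _) + (_ + _)
        rw [map_add, Completion.add_tmul, Completion.add_tmul]
        abel))
    (fun r s m => by
      have h : pd k (Poly k n) i • (DiffOp.ofFun r : D k n) • m =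
          (DiffOp.ofFun r : D k n) • pd k (Poly k n) i • m +
            (DiffOp.ofFun (MvPolynomial.pderiv i r) : D k n) • m := by
        have := congrArg (· • m) (pd_mul_ofFun (k := k) i r)
        simp only [mul_smul, add_smul] at this
        exact this
      have h' : MvPowerSeries.pderiv k i ((r : Series k n) * s) =
          (r : Series k n) * MvPowerSeries.pderiv k i s +
            (MvPolynomial.pderiv i r : Series k n) * s := by
        rw [Derivation.leibniz, MvPowerSeries.pderiv_coe]
        simp [mul_comm]
      change Completion.tmul k n (MvPowerSeries.pderiv k i ((r : Series k n) * s)) m +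
          Completion.tmul k n ((r : Series k n) * s) (pd k (Poly k n) i • m) =
        Completion.tmul k n (MvPowerSeries.pderiv k i s) ((DiffOp.ofFun r : D k n) • m) +
          Completion.tmul k n s (pd k (Poly k n) i • (DiffOp.ofFun r : D k n) • m)
      rw [h, h', Completion.tmul_add, Completion.add_tmul, Completion.tmul_ofFun,
        Completion.tmul_ofFun, Completion.tmul_ofFun]
      abel)

lemma Completion.del_tmul (i : Fin n) (s : Series k n) (m : M) :
    Completion.del k n M i (Completion.tmul k n s m) =
      Completion.tmul k n (MvPowerSeries.pderiv k i s) m +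
        Completion.tmul k n s (pd k (Poly k n) i • m) := rfl

lemma Completion.smul_tmul (r s : Series k n) (m : M) :
    r • Completion.tmul k n s m = Completion.tmul k n (r * s) m := rfl

lemma Completion.addHom_ext {N : Type u} [AddCommGroup N] {f g : Completion k n M →+ N}
    (h : ∀ s m, f (Completion.tmul k n s m) = g (Completion.tmul k n s m)) : f = g := by
  refine AddMonoidHom.ext fun z => ?_
  induction z using TensorProduct.induction_on with
  | zero => exact (map_zero f).trans (map_zero g).symm
  | tmul s m => exact h s m
  | add x y hx hy => exact (map_add f x y).trans ((congrArg₂ _ hx hy).trans (map_add g x y).symm)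

variable [CharZero k]

variable (M) in
/-- The action of `𝒟̂` on `M̂`: elements of `R̂` act by multiplication, and `∂ᵢ` acts through
`Completion.del`. -/
def Completion.action : DHat k n →+* AddMonoid.End (Completion k n M) :=
  DiffOp.lift (Module.toAddMonoidEnd (Series k n) (Completion k n M)) (Completion.del k n M)
    (fun i j => by
      refine Completion.addHom_ext k n fun s m => ?_
      change Completion.del k n M i (Completion.del k n M j (Completion.tmul k n s m)) =
        Completion.del k n M j (Completion.del k n M i (Completion.tmul k n s m))
      simp only [Completion.del_tmul, map_add]
      have h1 : pd k (Poly k n) i • pd k (Poly k n) j • m =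
          pd k (Poly k n) j • pd k (Poly k n) i • m := by
        rw [← mul_smul, ← mul_smul, (pd_comm i j).eq]
      have h2 : MvPowerSeries.pderiv k i (MvPowerSeries.pderiv k j s) =
          MvPowerSeries.pderiv k j (MvPowerSeries.pderiv k i s) :=
        Coordinates.der_comm (A := Series k n) i j s
      rw [h1, h2]; abel)
    (fun i r => by
      refine Completion.addHom_ext k n fun s m => ?_
      change Completion.del k n M i (r • Completion.tmul k n s m) =
        r • Completion.del k n M i (Completion.tmul k n s m) +
          (MvPowerSeries.pderiv k i r) • Completion.tmul k n s m
      rw [Completion.smul_tmul, Completion.smul_tmul, Completion.del_tmul,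
        Completion.del_tmul, Derivation.leibniz, smul_add, Completion.smul_tmul,
        Completion.smul_tmul, Completion.add_tmul, smul_eq_mul, smul_eq_mul,
        mul_comm s]
      abel)

instance Completion.module : Module (DHat k n) (Completion k n M) :=
  Module.compHom _ (Completion.action k n M)

lemma Completion.ofFun_smul (r : Series k n) (z : Completion k n M) :
    (DiffOp.ofFun r : DHat k n) • z = r • z := by
  have h : Completion.action k n M (DiffOp.ofFun r) =
      Module.toAddMonoidEnd (Series k n) (Completion k n M) r := DiffOp.lift_ofFun _ _ _ _ r
  exact congrArg (fun f : AddMonoid.End _ => f z) h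

lemma Completion.pd_smul (i : Fin n) (z : Completion k n M) :
    pd k (Series k n) i • z = Completion.del k n M i z := by
  have h : Completion.action k n M (pd k (Series k n) i) = Completion.del k n M i :=
    DiffOp.lift_pd _ _ _ _ i
  exact congrArg (fun f : AddMonoid.End _ => f z) h

/-- The natural map `κ : M → M̂`, `m ↦ 1 ⊗ m`, is semilinear along `𝒟 ⊆ 𝒟̂`. -/
def Completion.kappa : M →ₛₗ[toHat k n] Completion k n M where
  toFun m := Completion.tmul k n 1 m
  map_add' m m' := Completion.tmul_add k n 1 m m'
  map_smul' P m := by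
    revert m
    refine DiffOp.induction_gen
      (p := fun P : D k n => ∀ m : M, Completion.tmul k n 1 (P • m) =
        toHat k n P • Completion.tmul k n 1 m) ?_ ?_ ?_ ?_ P
    · intro r m
      rw [toHat, DiffOp.lift_ofFun, RingHom.comp_apply, Completion.ofFun_smul,
        Completion.smul_tmul, Completion.tmul_ofFun]
      rfl
    · intro i m
      rw [toHat, DiffOp.lift_pd, Completion.pd_smul, Completion.del_tmul,
        MvPowerSeries.pderiv_one]
      have h0 : Completion.tmul k n 0 m = 0 :=
        TensorProduct.zero_tmul (R := Poly k n) (Series k n) m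
      rw [h0, zero_add]
    · intro P Q hP hQ m
      rw [add_smul, Completion.tmul_add, map_add, add_smul, hP, hQ]
    · intro P Q hP hQ m
      rw [mul_smul, map_mul, mul_smul, hP, hQ]

/-- The inclusion `R^τ → R̂^τ`. -/
def polyToSeries : Transpose (Poly k n) →ₗ[k] Transpose (Series k n) :=
  (MvPolynomial.coeToMvPowerSeries.algHom k : Poly k n →ₐ[k] Series k n).toLinearMap

lemma polyToSeries_smul (P : (D k n)ᵐᵒᵖ) (r : Transpose (Poly k n)) :
    polyToSeries k n (P • r) = MulOpposite.op (toHat k n P.unop) • polyToSeries k n r := by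
  induction P using MulOpposite.rec' with
  | _ P =>
  revert r
  refine DiffOp.induction_gen
    (p := fun P : D k n => ∀ r : Transpose (Poly k n), polyToSeries k n (MulOpposite.op P • r) =
      MulOpposite.op (toHat k n P) • polyToSeries k n r) ?_ ?_ ?_ ?_ P
  · intro f r
    have h1 : tau (DiffOp.ofFun f : D k n) = MulOpposite.op (DiffOp.ofFun f) :=
      DiffOp.lift_ofFun _ _ _ _ f
    have h2 : tau (DiffOp.ofFun (f : Series k n) : DHat k n) =
        MulOpposite.op (DiffOp.ofFun (f : Series k n)) := DiffOp.lift_ofFun _ _ _ _ _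
    have h3 : toHat k n (DiffOp.ofFun f) = DiffOp.ofFun (f : Series k n) :=
      DiffOp.lift_ofFun _ _ _ _ f
    rw [h3]
    change (((tau (DiffOp.ofFun f : D k n)).unop.toEnd r : Poly k n) : Series k n) =
      (tau (DiffOp.ofFun (f : Series k n) : DHat k n)).unop.toEnd ((show Poly k n from r) : Series k n)
    rw [h1, h2]
    exact MvPolynomial.coe_mul f _
  · intro i r
    have h1 : tau (pd k (Poly k n) i) = MulOpposite.op (-pd k (Poly k n) i) :=
      DiffOp.lift_pd _ _ _ _ i
    have h2 : tau (pd k (Series k n) i) = MulOpposite.op (-pd k (Series k n) i) :=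
      DiffOp.lift_pd _ _ _ _ i
    have h3 : toHat k n (pd k (Poly k n) i) = pd k (Series k n) i :=
      DiffOp.lift_pd _ _ _ _ i
    rw [h3]
    change (((tau (pd k (Poly k n) i)).unop.toEnd r : Poly k n) : Series k n) =
      (tau (pd k (Series k n) i)).unop.toEnd ((show Poly k n from r) : Series k n)
    rw [h1, h2]
    revert r
    refine fun r : Poly k n => ?_
    change ((-MvPolynomial.pderiv i r : Poly k n) : Series k n) =
      -MvPowerSeries.pderiv k i (r : Series k n)
    rw [MvPowerSeries.pderiv_coe]
    exact map_neg (MvPolynomial.coeToMvPowerSeries.ringHom (σ := Fin n) (R := k)) _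
  · intro P Q hP hQ r
    rw [MulOpposite.op_add, add_smul, map_add, map_add, MulOpposite.op_add, add_smul, hP, hQ]
  · intro P Q hP hQ r
    rw [MulOpposite.op_mul, mul_smul, map_mul, MulOpposite.op_mul, mul_smul, hQ, hP]

end Completion

section Tensor

variable (k A : Type u) [CommRing k] [Ring A] (N : Type u) [AddCommGroup N] [Module k N]
  [Module Aᵐᵒᵖ N] [SMulCommClass k Aᵐᵒᵖ N] (M : Type u) [AddCommGroup M] [Module A M]

/-- The relations `n a ⊗ m = n ⊗ a m`. -/
def balancedRel : Submodule k (N ⊗[ℤ] M) :=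
  Submodule.span k {z | ∃ (n : N) (a : A) (m : M),
    z = (MulOpposite.op a • n) ⊗ₜ[ℤ] m - n ⊗ₜ[ℤ] (a • m)}

/-- The tensor product `N ⊗_A M` of a right module `N` and a left module `M` over a
noncommutative ring `A`. It is a `k`-module when `N` is a `k`-`A`-bimodule. -/
def BalancedTensor : Type u := (N ⊗[ℤ] M) ⧸ balancedRel k A N M

instance : AddCommGroup (BalancedTensor k A N M) :=
  inferInstanceAs (AddCommGroup ((N ⊗[ℤ] M) ⧸ balancedRel k A N M))

instance : Module k (BalancedTensor k A N M) :=
  inferInstanceAs (Module k ((N ⊗[ℤ] M) ⧸ balancedRel k A N M))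

end Tensor

section TensorMap

variable {k A B : Type u} [CommRing k] [Ring A] [Ring B] (ρ : A →+* B)
  {N N' : Type u} [AddCommGroup N] [Module k N] [Module Aᵐᵒᵖ N] [SMulCommClass k Aᵐᵒᵖ N]
  [AddCommGroup N'] [Module k N'] [Module Bᵐᵒᵖ N'] [SMulCommClass k Bᵐᵒᵖ N']
  {M M' : Type u} [AddCommGroup M] [Module A M] [AddCommGroup M'] [Module B M']

/-- The map `g ⊗ f : N ⊗_A M → N' ⊗_B M'` induced by maps `g` and `f` that are semilinear along
a ring homomorphism `ρ : A → B`. -/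
def BalancedTensor.map (g : N →ₗ[k] N')
    (hg : ∀ (a : A) (x : N), g (MulOpposite.op a • x) = MulOpposite.op (ρ a) • g x)
    (f : M →ₛₗ[ρ] M') : BalancedTensor k A N M →ₗ[k] BalancedTensor k B N' M' :=
  Submodule.mapQ _ _ (TensorProduct.AlgebraTensorModule.map g f.toAddMonoidHom.toIntLinearMap)
    (by
      refine Submodule.span_le.2 ?_
      rintro _ ⟨n, a, m, rfl⟩
      refine Submodule.subset_span ⟨g n, ρ a, f m, ?_⟩
      rw [map_sub]
      change g (MulOpposite.op a • n) ⊗ₜ[ℤ] f m - g n ⊗ₜ[ℤ] f (a • m) = _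
      rw [hg, map_smulₛₗ])

/-- The pure tensor `x ⊗ m`. -/
def BalancedTensor.tmul (x : N) (m : M) : BalancedTensor k A N M :=
  Submodule.Quotient.mk (x ⊗ₜ[ℤ] m)

lemma BalancedTensor.map_tmul (g : N →ₗ[k] N')
    (hg : ∀ (a : A) (x : N), g (MulOpposite.op a • x) = MulOpposite.op (ρ a) • g x)
    (f : M →ₛₗ[ρ] M') (x : N) (m : M) :
    BalancedTensor.map ρ g hg f (BalancedTensor.tmul x m) =
      BalancedTensor.tmul (g x) (f m) := rfl

lemma BalancedTensor.hom_ext {P : Type u} [AddCommGroup P] [Module k P]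
    {f f' : BalancedTensor k A N M →ₗ[k] P}
    (h : ∀ x m, f (BalancedTensor.tmul x m) = f' (BalancedTensor.tmul x m)) : f = f' := by
  refine LinearMap.ext fun z => ?_
  obtain ⟨z, rfl⟩ := Submodule.Quotient.mk_surjective _ z
  induction z using TensorProduct.induction_on with
  | zero => exact (map_zero f).trans (map_zero f').symm
  | tmul x m => exact h x m
  | add x y hx hy =>
    exact (map_add f (Submodule.Quotient.mk x) (Submodule.Quotient.mk y)).trans
      ((congrArg₂ _ hx hy).trans
        (map_add f' (Submodule.Quotient.mk x) (Submodule.Quotient.mk y)).symm)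

lemma BalancedTensor.tmul_add (x : N) (m m' : M) :
    (BalancedTensor.tmul x (m + m') : BalancedTensor k A N M) =
      BalancedTensor.tmul x m + BalancedTensor.tmul x m' :=
  congrArg Submodule.Quotient.mk (TensorProduct.tmul_add x m m')

end TensorMap

open CategoryTheory

section Functor

variable (k A : Type u) [CommRing k] [Ring A] (N : Type u) [AddCommGroup N] [Module k N]
  [Module Aᵐᵒᵖ N] [SMulCommClass k Aᵐᵒᵖ N]

/-- The functor `N ⊗_A -` from left `A`-modules to `k`-modules. -/
def tensorFunctor : ModuleCat.{u} A ⥤ ModuleCat.{u} k where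
  obj M := ModuleCat.of k (BalancedTensor k A N M)
  map f := ModuleCat.ofHom (BalancedTensor.map (RingHom.id A) LinearMap.id (fun _ _ => rfl) f.hom)
  map_id M := by
    refine ModuleCat.hom_ext (BalancedTensor.hom_ext fun x m => rfl)
  map_comp f g := by
    refine ModuleCat.hom_ext (BalancedTensor.hom_ext fun x m => rfl)

instance : (tensorFunctor k A N).Additive where
  map_add {X Y f g} := by
    refine ModuleCat.hom_ext (BalancedTensor.hom_ext fun x m => ?_)
    exact BalancedTensor.tmul_add x (f.hom m) (g.hom m)

/-- `Tor_j^A(N, M)`: the `j`-th left derived functor of `N ⊗_A -` at `M`. -/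
abbrev Tor (j : ℕ) (M : Type u) [AddCommGroup M] [Module A M] : ModuleCat.{u} k :=
  ((tensorFunctor k A N).leftDerived j).obj (ModuleCat.of A M)

end Functor

section ChangeOfRings

variable {k A B : Type u} [CommRing k] [Ring A] [Ring B] (ρ : A →+* B)
  {N N' : Type u} [AddCommGroup N] [Module k N] [Module Aᵐᵒᵖ N] [SMulCommClass k Aᵐᵒᵖ N]
  [AddCommGroup N'] [Module k N'] [Module Bᵐᵒᵖ N'] [SMulCommClass k Bᵐᵒᵖ N']

/-- The natural map `N ⊗_A X → N' ⊗_B X` for left `B`-modules `X`. -/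
def tensorChange (g : N →ₗ[k] N')
    (hg : ∀ (a : A) (x : N), g (MulOpposite.op a • x) = MulOpposite.op (ρ a) • g x) :
    ModuleCat.restrictScalars ρ ⋙ tensorFunctor k A N ⟶ tensorFunctor k B N' where
  app X := ModuleCat.ofHom (BalancedTensor.map (M := (ModuleCat.restrictScalars ρ).obj X)
    (M' := X) ρ g hg { toFun := fun x => x, map_add' := fun _ _ => rfl,
                       map_smul' := fun _ _ => rfl })
  naturality X Y f := by
    refine ModuleCat.hom_ext (BalancedTensor.hom_ext fun x m => rfl)

end ChangeOfRings

section Lift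

open CategoryTheory.Limits

variable {A B : Type u} [Ring A] [Ring B] (ρ : A →+* B)

/-- `B`-modules regarded as `A`-modules, termwise on complexes. -/
abbrev restrictComplex (K : ChainComplex (ModuleCat.{u} B) ℕ) : ChainComplex (ModuleCat.{u} A) ℕ :=
  ((ModuleCat.restrictScalars ρ).mapHomologicalComplex _).obj K

variable {X : ModuleCat.{u} A} {Y : ModuleCat.{u} B} (f : X ⟶ (ModuleCat.restrictScalars ρ).obj Y)
  (P : ProjectiveResolution X) (Q : ProjectiveResolution Y)

lemma restrict_map_exact {S : ShortComplex (ModuleCat.{u} B)} (h : S.Exact) :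
    (S.map (ModuleCat.restrictScalars ρ)).Exact := by
  rw [ShortComplex.ShortExact.moduleCat_exact_iff_function_exact] at h ⊢
  exact h

instance restrict_epi {Z Z' : ModuleCat.{u} B} (p : Z ⟶ Z') [Epi p] :
    Epi ((ModuleCat.restrictScalars ρ).map p) :=
  (ModuleCat.epi_iff_surjective _).2 ((ModuleCat.epi_iff_surjective p).1 inferInstance)

lemma restrict_exact_succ (n : ℕ) : (ShortComplex.mk _ _
    ((restrictComplex ρ Q.complex).d_comp_d (n + 2) (n + 1) n)).Exact :=
  restrict_map_exact ρ (Q.exact_succ n)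

/-- The augmentation `Q₀ → Y` of a resolution. -/
def augmentation : Q.complex.X 0 ⟶ Y := Q.π.f 0

instance : Epi (augmentation Q) := inferInstanceAs (Epi (Q.π.f 0))

lemma d_augmentation : Q.complex.d 1 0 ≫ augmentation Q = 0 := Q.complex_d_comp_π_f_zero

lemma exact_augmentation : (ShortComplex.mk _ _ (d_augmentation Q)).Exact := Q.exact₀

/-- Degree `0` of `liftRestrict`. -/
def liftRestrictZero : P.complex.X 0 ⟶ (ModuleCat.restrictScalars ρ).obj (Q.complex.X 0) :=
  Projective.factorThru (augmentation P ≫ f) ((ModuleCat.restrictScalars ρ).map (augmentation Q))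

lemma liftRestrictZero_comp : liftRestrictZero ρ f P Q ≫
    (ModuleCat.restrictScalars ρ).map (augmentation Q) = augmentation P ≫ f :=
  Projective.factorThru_comp _ _

lemma liftRestrictZero_aux : (P.complex.d 1 0 ≫ liftRestrictZero ρ f P Q) ≫
    (ModuleCat.restrictScalars ρ).map (augmentation Q) = 0 := by
  rw [Category.assoc, liftRestrictZero_comp, ← Category.assoc, d_augmentation, zero_comp]

/-- Degree `1` of `liftRestrict`. -/
def liftRestrictOne : P.complex.X 1 ⟶ (ModuleCat.restrictScalars ρ).obj (Q.complex.X 1) :=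
  (restrict_map_exact ρ (exact_augmentation Q)).liftFromProjective
    (P.complex.d 1 0 ≫ liftRestrictZero ρ f P Q) (liftRestrictZero_aux ρ f P Q)

lemma liftRestrictOne_comp : liftRestrictOne ρ f P Q ≫
    (ModuleCat.restrictScalars ρ).map (Q.complex.d 1 0) =
    P.complex.d 1 0 ≫ liftRestrictZero ρ f P Q :=
  (restrict_map_exact ρ (exact_augmentation Q)).liftFromProjective_comp _ _

/-- A lift of an `A`-linear map `f : X → Y` to a chain map from a projective resolution of the
`A`-module `X` to a projective resolution of the `B`-module `Y`, regarded as a complex of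
`A`-modules. It is unique up to homotopy. -/
def liftRestrict : P.complex ⟶ restrictComplex ρ Q.complex :=
  ChainComplex.mkHom _ _ (liftRestrictZero ρ f P Q) (liftRestrictOne ρ f P Q)
    (liftRestrictOne_comp ρ f P Q)
    fun n ⟨_, g', w⟩ =>
      ⟨(restrict_exact_succ ρ Q n).liftFromProjective (P.complex.d (n + 2) (n + 1) ≫ g')
        (by
          change (P.complex.d (n + 2) (n + 1) ≫ g') ≫ (restrictComplex ρ Q.complex).d (n + 1) n = 0
          rw [Category.assoc, w, ← Category.assoc, P.complex.d_comp_d, zero_comp]),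
       (restrict_exact_succ ρ Q n).liftFromProjective_comp _ _⟩

lemma liftRestrict_comp : (liftRestrict ρ f P Q).f 0 ≫
    (ModuleCat.restrictScalars ρ).map (augmentation Q) = augmentation P ≫ f := by
  exact liftRestrictZero_comp ρ f P Q

end Lift

section TorMap

variable {k A B : Type u} [CommRing k] [Ring A] [Ring B] (ρ : A →+* B)
  {N N' : Type u} [AddCommGroup N] [Module k N] [Module Aᵐᵒᵖ N] [SMulCommClass k Aᵐᵒᵖ N]
  [AddCommGroup N'] [Module k N'] [Module Bᵐᵒᵖ N'] [SMulCommClass k Bᵐᵒᵖ N']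
  {M M' : Type u} [AddCommGroup M] [Module A M] [AddCommGroup M'] [Module B M']

/-- A map `M → M'` that is semilinear along `ρ`, as an `A`-linear map. -/
def semilinearHom (f : M →ₛₗ[ρ] M') :
    ModuleCat.of A M ⟶ (ModuleCat.restrictScalars ρ).obj (ModuleCat.of B M') :=
  ModuleCat.ofHom (Y := (ModuleCat.restrictScalars ρ).obj (ModuleCat.of B M'))
    { toFun := f, map_add' := map_add f, map_smul' := fun a m => map_smulₛₗ f a m }

/-- The natural map `Tor_j^A(N, M) → Tor_j^B(N', M')` induced by a ring homomorphism `ρ : A → B`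
and maps `g : N → N'` and `f : M → M'` that are semilinear along `ρ`. If `P → M` and `Q → M'` are
projective resolutions over `A` and `B`, and `φ : P → Q` is an `A`-linear chain map lifting `f`,
then it is the map on homology of `g ⊗ φ : N ⊗_A P → N' ⊗_B Q`. -/
def torMap (g : N →ₗ[k] N')
    (hg : ∀ (a : A) (x : N), g (MulOpposite.op a • x) = MulOpposite.op (ρ a) • g x)
    (f : M →ₛₗ[ρ] M') (j : ℕ) : Tor k A N j M →ₗ[k] Tor k B N' j M' :=
  let P := projectiveResolution (ModuleCat.of A M)
  let Q := projectiveResolution (ModuleCat.of B M')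
  let Φ : ((tensorFunctor k A N).mapHomologicalComplex _).obj P.complex ⟶
      ((tensorFunctor k B N').mapHomologicalComplex _).obj Q.complex :=
    ((tensorFunctor k A N).mapHomologicalComplex _).map
        (liftRestrict ρ (semilinearHom ρ f) P Q) ≫
      (NatTrans.mapHomologicalComplex (tensorChange ρ g hg) _).app Q.complex
  ((P.isoLeftDerivedObj (tensorFunctor k A N) j).hom ≫
    HomologicalComplex.homologyMap Φ j ≫
    (Q.isoLeftDerivedObj (tensorFunctor k B N') j).inv).hom

end TorMap

section Statement

variable (k : Type u) [Field k] [CharZero k] (n : ℕ)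

/-- The natural map `ι_j : Tor_j^𝒟(R^τ, M) → Tor_j^𝒟̂(R̂^τ, M̂)` induced by `M → M̂`. -/
def iota (M : Type u) [AddCommGroup M] [Module (D k n) M] (j : ℕ) :
    Tor k (D k n) (Transpose (Poly k n)) j M →ₗ[k]
      Tor k (DHat k n) (Transpose (Series k n)) j (Completion k n M) :=
  torMap (toHat k n) (polyToSeries k n) (fun P => polyToSeries_smul k n (MulOpposite.op P))
    (Completion.kappa k n) j

/-- A grading `M = ⨁ M_l` of the underlying `R`-module of a `𝒟`-module `M` makes it a graded
`𝒟`-module if `∂ᵢ M_l ⊆ M_{l-1}`. -/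
structure IsGradedDModule {M : Type u} [AddCommGroup M] [Module (D k n) M]
    (ℳ : ℤ → AddSubgroup M) : Prop where
  isInternal : DirectSum.IsInternal ℳ
  poly_smul : ∀ (d : ℕ) (l : ℤ) (r : Poly k n) (m : M), r.IsHomogeneous d → m ∈ ℳ l →
    (DiffOp.ofFun r : D k n) • m ∈ ℳ (d + l)
  pd_smul : ∀ (i : Fin n) (l : ℤ) (m : M), m ∈ ℳ l → pd k (Poly k n) i • m ∈ ℳ (l - 1)

end Statement

end

end DMod

/-! The point is that `ι_j` compares a direct sum of vector spaces with the product of the same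
spaces.

In characteristic zero every differential operator has a unique normal form `∑ f_α ∂^α`, both over
`R` and over `R̂`. This makes `𝒟` a ℤ-graded ring, with `xᵢ` in degree `1` and `∂ᵢ` in degree `-1`
(`isGrading_gradeD`, `mul_mem_gradeD`). It is also left Noetherian, by passing to leading symbols
(`isNoetherianRing_D`). Hence a finitely generated graded `M` has a resolution by graded free
modules `𝒟^{b_j}` of finite rank whose differentials are homogeneous matrices
(`exists_graded_resolution`).

Since `R̂` is flat over `R` and `R̂ ⊗_R 𝒟^b ≃ 𝒟̂^b` by the normal form (`freeCompletionEquiv`), the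
same matrices read over `𝒟̂` resolve `M̂` (`exact_hat`, `exact_hat_augmentation`). The natural map
does not depend on the resolutions or on the lift (`torMap_eq`), so it is computed by the entrywise
inclusion `𝒟^{b_j} → 𝒟̂^{b_j}`. After tensoring, this is the inclusion of the complex `K` with terms
`R^{b_j}` into the complex `L` with terms `R̂^{b_j}`, the differentials being given by the same
homogeneous matrices (`freeTensorCoord_d`, `freeTensorCoord_tensorChainMap`).

Homogeneous matrices commute with taking homogeneous components (`hcomp_op_smul`), once these are
shifted by the degrees of the basis vectors. So `K = ⨁ K_l` and `L = ∏ K_l` as complexes, which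
`IsGradedCompletion` expresses through chain maps `π l : L ⟶ K` with image `K_l`. On homology the
map is `⨁ H_j(K_l) → ∏ H_j(K_l)`. It is always injective
(`IsGradedCompletion.homologyMap_injective`). If the left side is finite-dimensional, only finitely
many `H_j(K_l)` are nonzero and it is bijective (`IsGradedCompletion.homologyMap_surjective`). -/

namespace DMod

noncomputable section

open CategoryTheory CategoryTheory.Limits

/-! ### Uniqueness of lifts up to homotopy. -/

section LiftHomotopy

universe v w

variable {C : Type w} [Category.{v} C] [Abelian C] {P K : ChainComplex C ℕ} {Z : C}
  [∀ i, Projective (P.X i)] {π : K.X 0 ⟶ Z} {hπ : K.d 1 0 ≫ π = 0}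

/-- A chain map from a complex of projectives to an acyclic complex that vanishes after
augmentation is null-homotopic. -/
def homotopyZeroOfExact (h0 : (ShortComplex.mk _ _ hπ).Exact)
    (hK : ∀ n, (ShortComplex.mk _ _ (K.d_comp_d (n + 2) (n + 1) n)).Exact)
    (f : P ⟶ K) (comm : f.f 0 ≫ π = 0) : Homotopy f 0 :=
  have e0 : h0.liftFromProjective (f.f 0) comm ≫ K.d 1 0 = f.f 0 :=
    h0.liftFromProjective_comp _ _
  -- What the degree-zero homotopy fails to account for in degree one is a cycle, so it lifts
  -- through the next differential. The inductive step repeats this.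
  have c1 : (f.f 1 - P.d 1 0 ≫ h0.liftFromProjective (f.f 0) comm) ≫ K.d 1 0 = 0 := by
    rw [Preadditive.sub_comp, Category.assoc, e0, f.comm, sub_self]
  have e1 : (hK 0).liftFromProjective _ c1 ≫ K.d 2 1 =
      f.f 1 - P.d 1 0 ≫ h0.liftFromProjective (f.f 0) comm :=
    (hK 0).liftFromProjective_comp _ _
  Homotopy.mkInductive _ (h0.liftFromProjective (f.f 0) comm) e0.symm
    ((hK 0).liftFromProjective _ c1) (add_eq_of_eq_sub' e1).symm
    fun n ⟨_, g', w⟩ =>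
      ⟨(hK (n + 1)).liftFromProjective (f.f (n + 2) - P.d (n + 2) (n + 1) ≫ g') (by
          change _ ≫ K.d (n + 2) (n + 1) = 0
          rw [Preadditive.sub_comp, f.comm, w]
          simp),
      (add_eq_of_eq_sub' ((hK (n + 1)).liftFromProjective_comp _ _)).symm⟩

/-- Two chain maps from a complex of projectives to an acyclic complex that agree after
augmentation are homotopic. -/
def homotopyOfExact (h0 : (ShortComplex.mk _ _ hπ).Exact)
    (hK : ∀ n, (ShortComplex.mk _ _ (K.d_comp_d (n + 2) (n + 1) n)).Exact)
    (f g : P ⟶ K) (comm : f.f 0 ≫ π = g.f 0 ≫ π) : Homotopy f g :=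
  Homotopy.equivSubZero.invFun (homotopyZeroOfExact h0 hK (f - g) (by
    rw [HomologicalComplex.sub_f_apply, Preadditive.sub_comp, comm, sub_self]))

end LiftHomotopy

/-! ### Independence of the natural map on Tor from resolutions and lifts. -/

section TorMap

variable {k A B : Type u} [CommRing k] [Ring A] [Ring B] (ρ : A →+* B)
  {N N' : Type u} [AddCommGroup N] [Module k N] [Module Aᵐᵒᵖ N] [SMulCommClass k Aᵐᵒᵖ N]
  [AddCommGroup N'] [Module k N'] [Module Bᵐᵒᵖ N'] [SMulCommClass k Bᵐᵒᵖ N']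
  {M M' : Type u} [AddCommGroup M] [Module A M] [AddCommGroup M'] [Module B M']

/-- The augmentation of a resolution over `B`, as an `A`-linear map. -/
def restrictAugmentation {Y : ModuleCat.{u} B} (Q : ProjectiveResolution Y) :
    (restrictComplex ρ Q.complex).X 0 ⟶ (ModuleCat.restrictScalars ρ).obj Y :=
  (ModuleCat.restrictScalars ρ).map (augmentation Q)

lemma d_restrictAugmentation {Y : ModuleCat.{u} B} (Q : ProjectiveResolution Y) :
    (restrictComplex ρ Q.complex).d 1 0 ≫ restrictAugmentation ρ Q = 0 :=
  (((ShortComplex.mk _ _ (d_augmentation Q)).map (ModuleCat.restrictScalars ρ))).zero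

/-- The restriction along `ρ` of a chain map of `B`-modules. -/
abbrev restrictMap {Q Q' : ChainComplex (ModuleCat.{u} B) ℕ} (b : Q ⟶ Q') :
    restrictComplex ρ Q ⟶ restrictComplex ρ Q' :=
  ((ModuleCat.restrictScalars ρ).mapHomologicalComplex _).map b

lemma restrictMap_augmentation {Y : ModuleCat.{u} B} {Q Q' : ProjectiveResolution Y}
    (b : Q.complex ⟶ Q'.complex) (hb : b.f 0 ≫ augmentation Q' = augmentation Q) :
    (restrictMap ρ b).f 0 ≫ restrictAugmentation ρ Q' = restrictAugmentation ρ Q := by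
  have h := congrArg (ModuleCat.restrictScalars ρ).map hb
  rw [Functor.map_comp] at h
  exact h

/-- The chain map `N ⊗_A Q → N' ⊗_B Q` for a complex `Q` of `B`-modules. -/
def tensorChangeComplex (g : N →ₗ[k] N')
    (hg : ∀ (a : A) (x : N), g (MulOpposite.op a • x) = MulOpposite.op (ρ a) • g x)
    (Q : ChainComplex (ModuleCat.{u} B) ℕ) :
    ((tensorFunctor k A N).mapHomologicalComplex _).obj (restrictComplex ρ Q) ⟶
      ((tensorFunctor k B N').mapHomologicalComplex _).obj Q :=
  (NatTrans.mapHomologicalComplex (tensorChange ρ g hg) _).app Q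

lemma tensorChangeComplex_naturality (g : N →ₗ[k] N')
    (hg : ∀ (a : A) (x : N), g (MulOpposite.op a • x) = MulOpposite.op (ρ a) • g x)
    {Q Q' : ChainComplex (ModuleCat.{u} B) ℕ} (b : Q ⟶ Q') :
    ((tensorFunctor k A N).mapHomologicalComplex _).map (restrictMap ρ b) ≫
      tensorChangeComplex ρ g hg Q' =
    tensorChangeComplex ρ g hg Q ≫ ((tensorFunctor k B N').mapHomologicalComplex _).map b :=
  (NatTrans.mapHomologicalComplex (tensorChange ρ g hg) _).naturality b

/-- The chain map `N ⊗_A P → N' ⊗_B Q` induced by an `A`-linear chain map `P → Q`. -/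
def tensorChainMap (g : N →ₗ[k] N')
    (hg : ∀ (a : A) (x : N), g (MulOpposite.op a • x) = MulOpposite.op (ρ a) • g x)
    {P : ChainComplex (ModuleCat.{u} A) ℕ} {Q : ChainComplex (ModuleCat.{u} B) ℕ}
    (φ : P ⟶ restrictComplex ρ Q) :
    ((tensorFunctor k A N).mapHomologicalComplex _).obj P ⟶
      ((tensorFunctor k B N').mapHomologicalComplex _).obj Q :=
  ((tensorFunctor k A N).mapHomologicalComplex _).map φ ≫ tensorChangeComplex ρ g hg Q

/-- `torMap` can be computed with any projective resolutions and any lift. -/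
lemma torMap_eq (g : N →ₗ[k] N')
    (hg : ∀ (a : A) (x : N), g (MulOpposite.op a • x) = MulOpposite.op (ρ a) • g x)
    (f : M →ₛₗ[ρ] M') (P' : ProjectiveResolution (ModuleCat.of A M))
    (Q' : ProjectiveResolution (ModuleCat.of B M'))
    (φ : P'.complex ⟶ restrictComplex ρ Q'.complex)
    (hφ : φ.f 0 ≫ restrictAugmentation ρ Q' = augmentation P' ≫ semilinearHom ρ f) (j : ℕ) :
    torMap ρ g hg f j = ((P'.isoLeftDerivedObj (tensorFunctor k A N) j).hom ≫
      HomologicalComplex.homologyMap (tensorChainMap ρ g hg φ) j ≫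
      (Q'.isoLeftDerivedObj (tensorFunctor k B N') j).inv).hom := by
  let P := projectiveResolution (ModuleCat.of A M)
  let Q := projectiveResolution (ModuleCat.of B M')
  -- The comparison maps go `P → P'` and `Q' → Q`, so that `φ : P' → Q'` can be sandwiched into a
  -- second lift `P → Q`.
  let a : P.complex ⟶ P'.complex := ProjectiveResolution.lift (𝟙 _) P P'
  let b : Q'.complex ⟶ Q.complex := ProjectiveResolution.lift (𝟙 _) Q' Q
  have ha : a.f 0 ≫ P'.π.f 0 = P.π.f 0 ≫ 𝟙 _ := ProjectiveResolution.lift_commutes_zero _ _ _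
  have hb : b.f 0 ≫ Q.π.f 0 = Q'.π.f 0 ≫ 𝟙 _ := ProjectiveResolution.lift_commutes_zero _ _ _
  have ha' : a.f 0 ≫ augmentation P' = augmentation P := ha.trans (Category.comp_id _)
  have hb' := restrictMap_augmentation ρ b (hb.trans (Category.comp_id _))
  have e1 := ProjectiveResolution.isoLeftDerivedObj_hom_naturality (𝟙 _) P P' a ha
    (tensorFunctor k A N) j
  have e2 := ProjectiveResolution.isoLeftDerivedObj_inv_naturality (𝟙 _) Q' Q b hb
    (tensorFunctor k B N') j
  rw [CategoryTheory.Functor.map_id, Category.id_comp] at e1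
  rw [CategoryTheory.Functor.map_id, Category.comp_id] at e2
  have hl : (liftRestrict ρ (semilinearHom ρ f) P Q).f 0 ≫ restrictAugmentation ρ Q =
    augmentation P ≫ semilinearHom ρ f := liftRestrict_comp _ _ _ _
  -- Both sides lift the same map. The terms of `Q` need not be projective over `A`; only
  -- projectivity of `P` over `A` and exactness of `Q` enter.
  have H : Homotopy (liftRestrict ρ (semilinearHom ρ f) P Q) (a ≫ φ ≫ restrictMap ρ b) := by
    refine homotopyOfExact (hπ := d_restrictAugmentation ρ Q)
      (restrict_map_exact ρ (exact_augmentation Q)) (restrict_exact_succ ρ Q) _ _ ?_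
    rw [hl, HomologicalComplex.comp_f, HomologicalComplex.comp_f, Category.assoc, Category.assoc,
      hb', hφ, ← ha', Category.assoc]
  have H2 : HomologicalComplex.homologyMap
        (tensorChainMap ρ g hg (liftRestrict ρ (semilinearHom ρ f) P Q)) j =
      HomologicalComplex.homologyMap (((tensorFunctor k A N).mapHomologicalComplex _).map a) j ≫
      HomologicalComplex.homologyMap (tensorChainMap ρ g hg φ) j ≫
      HomologicalComplex.homologyMap (((tensorFunctor k B N').mapHomologicalComplex _).map b) j := by
    have h := (((tensorFunctor k A N).mapHomotopy H).compRight
      (tensorChangeComplex ρ g hg Q.complex)).homologyMap_eq j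
    refine h.trans ?_
    rw [← HomologicalComplex.homologyMap_comp, ← HomologicalComplex.homologyMap_comp]
    congr 1
    -- Naturality of the change of rings moves `b` from the `A`-side to the `B`-side.
    rw [tensorChainMap, Functor.map_comp, Functor.map_comp, Category.assoc, Category.assoc,
      Category.assoc, tensorChangeComplex_naturality]
  change ((P.isoLeftDerivedObj (tensorFunctor k A N) j).hom ≫
    HomologicalComplex.homologyMap (tensorChainMap ρ g hg _) j ≫
    (Q.isoLeftDerivedObj (tensorFunctor k B N') j).inv).hom = _
  rw [H2, e1, e2]
  congr 1

end TorMap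

end

end DMod

namespace DMod

noncomputable section

open CategoryTheory CategoryTheory.Limits

/-! ### Cycles and boundaries of complexes of modules, by elements. -/

section Elements

variable {k : Type u} [CommRing k] {K L : ChainComplex (ModuleCat.{u} k) ℕ} {j : ℕ}

lemma exists_cycle (h : K.homology j) : ∃ z : K.cycles j, K.homologyπ j z = h :=
  (ModuleCat.epi_iff_surjective (K.homologyπ j)).1 inferInstance h

lemma iCycles_injective : Function.Injective (K.iCycles j) :=
  (ModuleCat.mono_iff_injective (K.iCycles j)).1 inferInstance

/-- Homology is the cokernel of `K.toCycles`. The equation is stated in `K.X j` so that chain maps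
can be applied to it directly. -/
lemma exists_boundary {z : K.cycles j} (hz : K.homologyπ j z = 0) :
    ∃ y : K.X (j + 1), K.d (j + 1) j y = K.iCycles j z := by
  have he : (ShortComplex.mk (K.toCycles (j + 1) j) (K.homologyπ j)
      (K.toCycles_comp_homologyπ _ _)).Exact :=
    ShortComplex.exact_of_g_is_cokernel _ (K.homologyIsCokernel (j + 1) j (by simp))
  obtain ⟨y, hy⟩ := (ShortComplex.moduleCat_exact_iff _).1 he z hz
  refine ⟨y, ?_⟩
  have hy' : K.toCycles (j + 1) j y = z := hy
  rw [← hy']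
  exact (congrArg (fun f => f.hom y) (K.toCycles_i (j + 1) j)).symm

lemma homologyπ_eq_zero {z : K.cycles j} {y : K.X (j + 1)}
    (hy : K.d (j + 1) j y = K.iCycles j z) : K.homologyπ j z = 0 := by
  have h1 : K.toCycles (j + 1) j y = z := by
    apply iCycles_injective
    rw [← hy]
    exact (congrArg (fun f => f.hom y) (K.toCycles_i (j + 1) j))
  rw [← h1]
  exact congrArg (fun f => f.hom y) (K.toCycles_comp_homologyπ (j + 1) j)

lemma homologyMap_π (φ : K ⟶ L) (z : K.cycles j) :
    HomologicalComplex.homologyMap φ j (K.homologyπ j z) =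
      L.homologyπ j (HomologicalComplex.cyclesMap φ j z) :=
  congrArg (fun f => f.hom z) (HomologicalComplex.homologyπ_naturality φ j)

lemma iCycles_cyclesMap (φ : K ⟶ L) (z : K.cycles j) :
    L.iCycles j (HomologicalComplex.cyclesMap φ j z) = φ.f j (K.iCycles j z) :=
  congrArg (fun f => f.hom z) (HomologicalComplex.cyclesMap_i φ j)

lemma hom_d (φ : K ⟶ L) (i i' : ℕ) (x : K.X i) : φ.f i' (K.d i i' x) = L.d i i' (φ.f i x) :=
  congrArg (fun f => f.hom x) (φ.comm i i').symm

end Elements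

/-! ### Homology of a direct sum of complexes against that of the product. -/

section Graded

variable {k : Type u} [Field k] {K L : ChainComplex (ModuleCat.{u} k) ℕ}

/-- A chain map `ι : K → L` that identifies `K` with a direct sum of graded pieces and `L` with
the product of the same pieces; `π l` is the projection to the piece of degree `l`. -/
structure IsGradedCompletion (ι : K ⟶ L) (π : ℤ → (L ⟶ K)) : Prop where
  sum : ∀ (j : ℕ) (x : K.X j), ∃ s : Finset ℤ, ∀ t, s ⊆ t → ∑ l ∈ t, (π l).f j (ι.f j x) = x
  proj_self : ∀ (j : ℕ) (l : ℤ) (y : L.X j), (π l).f j (ι.f j ((π l).f j y)) = (π l).f j y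
  proj_ne : ∀ (j : ℕ) (l m : ℤ) (y : L.X j), l ≠ m → (π l).f j (ι.f j ((π m).f j y)) = 0
  prod : ∀ (j : ℕ) (x : ℤ → K.X j), ∃ y : L.X j, ∀ l, (π l).f j y = (π l).f j (ι.f j (x l))
  ext : ∀ (j : ℕ) (y : L.X j), (∀ l, (π l).f j y = 0) → y = 0

variable {ι : K ⟶ L} {π : ℤ → (L ⟶ K)}

/-- If `ι x = d y` in `L`, then each component of `x` is `π l (ι x) = d (π l y)`. As `x` has only
finitely many components, the finite sum of the corresponding `π l y` bounds it in `K`. -/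
theorem IsGradedCompletion.homologyMap_injective (h : IsGradedCompletion ι π) (j : ℕ) :
    Function.Injective (HomologicalComplex.homologyMap ι j) := by
  refine (injective_iff_map_eq_zero (HomologicalComplex.homologyMap ι j).hom).2 fun a ha => ?_
  obtain ⟨z, rfl⟩ := exists_cycle a
  have ha' : L.homologyπ j (HomologicalComplex.cyclesMap ι j z) = 0 :=
    (homologyMap_π ι z).symm.trans ha
  obtain ⟨y, hy⟩ := exists_boundary ha'
  rw [iCycles_cyclesMap] at hy
  obtain ⟨s, hs⟩ := h.sum j (K.iCycles j z)
  refine homologyπ_eq_zero (y := ∑ l ∈ s, (π l).f (j + 1) y) ?_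
  rw [map_sum, ← hs s subset_rfl]
  refine Finset.sum_congr rfl fun l _ => ?_
  rw [← hom_d, hy]

/-- All but finitely many components of a cycle of `L` are boundaries in `K`. The chains bounding
them can be assembled into one chain of `L`, since `L` is a product, and subtracting its boundary
leaves a finite sum of cycles of `K`. -/
theorem IsGradedCompletion.homologyMap_surjective (h : IsGradedCompletion ι π) (j : ℕ)
    [FiniteDimensional k (K.homology j)] :
    Function.Surjective (HomologicalComplex.homologyMap ι j) := by
  intro a
  obtain ⟨z, rfl⟩ := exists_cycle a
  let c : ℤ → K.cycles j := fun l => HomologicalComplex.cyclesMap (π l) j z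
  -- The projection of the homology of `K` to its degree `l` part.
  let e : ℤ → Module.End k (K.homology j) := fun l =>
    (HomologicalComplex.homologyMap (ι ≫ π l) j).hom
  have hc : ∀ l, K.iCycles j (c l) = (π l).f j (L.iCycles j z) := fun l => iCycles_cyclesMap _ _
  have he : ∀ l m, e l (K.homologyπ j (c m)) = if l = m then K.homologyπ j (c m) else 0 := by
    intro l m
    have h1 : e l (K.homologyπ j (c m)) =
      K.homologyπ j (HomologicalComplex.cyclesMap (ι ≫ π l) j (c m)) := homologyMap_π _ _
    have h2 : K.iCycles j (HomologicalComplex.cyclesMap (ι ≫ π l) j (c m)) =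
        (π l).f j (ι.f j ((π m).f j (L.iCycles j z))) := by
      rw [iCycles_cyclesMap, hc]; rfl
    rw [h1]
    split_ifs with hlm
    · subst hlm
      congr 1
      apply iCycles_injective
      rw [h2, h.proj_self, hc]
    · have : HomologicalComplex.cyclesMap (ι ≫ π l) j (c m) = 0 := by
        apply iCycles_injective
        rw [h2, h.proj_ne _ _ _ _ hlm, map_zero]
      rw [this, map_zero]
  -- Nonzero classes in distinct degrees are linearly independent: applying `e i` to a relation
  -- isolates its `i`-th term.
  have hfin : {l | K.homologyπ j (c l) ≠ 0}.Finite := by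
    let T : Set ℤ := {l | K.homologyπ j (c l) ≠ 0}
    have hli : LinearIndependent k (fun l : T => K.homologyπ j (c l)) := by
      rw [linearIndependent_iff']
      intro s g hg i hi
      have := congrArg (e i) hg
      rw [map_sum, map_zero, Finset.sum_eq_single i] at this
      · rw [map_smul, he, if_pos rfl] at this
        exact (smul_eq_zero.1 this).resolve_right i.2
      · intro m _ hm
        rw [map_smul, he, if_neg (fun h' => hm (Subtype.ext h'.symm)), smul_zero]
      · intro h'; exact absurd hi h'
    exact Set.finite_coe_iff.1 hli.finite
  -- In the finitely many exceptional degrees nothing is required of `y`, and `0` is used.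
  have hb : ∀ l, ∃ y : K.X (j + 1), l ∉ hfin.toFinset →
      K.d (j + 1) j y = (π l).f j (L.iCycles j z) := by
    intro l
    by_cases hl : K.homologyπ j (c l) = 0
    · obtain ⟨y, hy⟩ := exists_boundary hl
      exact ⟨y, fun _ => hy.trans (hc l)⟩
    · exact ⟨0, fun h' => absurd (by simpa using hl) h'⟩
  choose y hy using hb
  obtain ⟨Y, hY⟩ := h.prod (j + 1) fun l => if l ∈ hfin.toFinset then 0 else y l
  refine ⟨∑ l ∈ hfin.toFinset, K.homologyπ j (c l), ?_⟩
  rw [map_sum, ← sub_eq_zero]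
  have e1 : ∑ l ∈ hfin.toFinset, HomologicalComplex.homologyMap ι j (K.homologyπ j (c l)) -
      L.homologyπ j z = L.homologyπ j
        (∑ l ∈ hfin.toFinset, HomologicalComplex.cyclesMap ι j (c l) - z) := by
    rw [map_sub, map_sum]
    congr 1
    exact Finset.sum_congr rfl fun l _ => homologyMap_π _ _
  rw [e1]
  -- The finite sum minus `z` has component `0` in the exceptional degrees and minus that of `z`
  -- elsewhere; this is the boundary of `-Y`.
  refine homologyπ_eq_zero (y := -Y) ?_
  rw [← sub_eq_zero]
  refine h.ext j _ fun m => ?_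
  rw [map_sub, map_neg, map_neg, hom_d, hY, map_sub, map_sub, map_sum, map_sum]
  have e2 : ∀ l, (π m).f j (L.iCycles j (HomologicalComplex.cyclesMap ι j (c l))) =
      if m = l then (π m).f j (L.iCycles j z) else 0 := by
    intro l
    rw [iCycles_cyclesMap, hc]
    split_ifs with hml
    · subst hml; exact h.proj_self _ _ _
    · exact h.proj_ne _ _ _ _ hml
  simp only [e2]
  rw [Finset.sum_ite_eq, ← hom_d, ← hom_d]
  by_cases hm : m ∈ hfin.toFinset
  · simp [hm]
  · rw [if_neg hm, if_neg hm, hy m hm, h.proj_self]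
    abel

end Graded

end

end DMod

namespace DMod

noncomputable section

set_option linter.unusedSectionVars false

open CategoryTheory CategoryTheory.Limits

/-! ### Projective resolutions from exact sequences of linear maps. -/

section Resolution

variable {A : Type u} [Ring A] {X : ℕ → Type u} [∀ j, AddCommGroup (X j)] [∀ j, Module A (X j)]
  (d : ∀ j, X (j + 1) →ₗ[A] X j) (hd : ∀ j, Function.Exact (d (j + 1)) (d j))

/-- The chain complex of an exact sequence of linear maps. -/
def exactComplex : ChainComplex (ModuleCat.{u} A) ℕ :=
  ChainComplex.of (fun j => ModuleCat.of A (X j)) (fun j => ModuleCat.ofHom (d j))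
    fun j => ModuleCat.hom_ext (hd j).linearMap_comp_eq_zero

lemma exactComplex_d (j : ℕ) : (exactComplex d hd).d (j + 1) j = ModuleCat.ofHom (d j) :=
  ChainComplex.of_d (fun j => ModuleCat.of A (X j)) (fun j => ModuleCat.ofHom (d j)) j

variable {M : Type u} [AddCommGroup M] [Module A M] (ε : X 0 →ₗ[A] M)
  [∀ j, Module.Projective A (X j)]

lemma exactComplex_d_comp (hε : Function.Exact (d 0) ε) :
    (exactComplex d hd).d 1 0 ≫ (ModuleCat.ofHom ε : (exactComplex d hd).X 0 ⟶ ModuleCat.of A M) =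
      0 := by
  rw [exactComplex_d]
  exact ModuleCat.hom_ext hε.linearMap_comp_eq_zero

lemma exactComplex_exactAt (j : ℕ) : (exactComplex d hd).ExactAt (j + 1) := by
  rw [HomologicalComplex.exactAt_iff' _ (j + 2) (j + 1) j (by simp) (by simp)]
  rw [ShortComplex.ShortExact.moduleCat_exact_iff_function_exact]
  change Function.Exact ((exactComplex d hd).d (j + 2) (j + 1)) ((exactComplex d hd).d (j + 1) j)
  rw [exactComplex_d, exactComplex_d]
  exact hd j

/-- The projective resolution given by an exact sequence of projective modules. -/
def exactResolution (hε : Function.Exact (d 0) ε) (hs : Function.Surjective ε) :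
    ProjectiveResolution (ModuleCat.of A M) where
  complex := exactComplex d hd
  projective j := by
    change Projective (ModuleCat.of A (X j))
    exact (IsProjective.iff_projective (R := A) (X j)).1 inferInstance
  π := (ChainComplex.toSingle₀Equiv _ _).symm ⟨ModuleCat.ofHom ε, exactComplex_d_comp d hd ε hε⟩
  quasiIso := ⟨fun j => by
    cases j with
    | zero =>
      -- In degree `0` being a quasi-isomorphism means exactness at `X 0` together with surjectivity
      -- of `ε`.
      rw [ChainComplex.quasiIsoAt₀_iff, ShortComplex.quasiIso_iff_of_zeros']
      · refine (ShortComplex.exact_and_epi_g_iff_of_iso (S₂ :=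
          ShortComplex.mk _ _ (exactComplex_d_comp d hd ε hε)) ?_).2 ⟨?_, ?_⟩
        · exact ShortComplex.isoMk (Iso.refl _) (Iso.refl _) (Iso.refl _)
            ((Category.id_comp _).trans (Category.comp_id _).symm)
            (by
              have h := ChainComplex.toSingle₀Equiv_symm_apply_f_zero _
                (exactComplex_d_comp d hd ε hε)
              refine (Category.id_comp _).trans (Eq.trans ?_ (Category.comp_id _).symm)
              exact h.symm)
        · rw [ShortComplex.ShortExact.moduleCat_exact_iff_function_exact]
          change Function.Exact ((exactComplex d hd).d 1 0) ε
          rw [exactComplex_d]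
          exact hε
        · exact (ModuleCat.epi_iff_surjective _).2 hs
      all_goals rfl
    | succ j =>
      rw [quasiIsoAt_iff_exactAt']
      · exact exactComplex_exactAt d hd j
      · apply ChainComplex.exactAt_succ_single_obj⟩

lemma augmentation_exactResolution (hε : Function.Exact (d 0) ε) (hs : Function.Surjective ε)
    (x : X 0) :
    augmentation (exactResolution d hd ε hε hs) x = ε x := by
  have : augmentation (exactResolution d hd ε hε hs) = ModuleCat.ofHom ε :=
    ChainComplex.toSingle₀Equiv_symm_apply_f_zero _ (exactComplex_d_comp d hd ε hε)
  exact congrArg (fun f => f.hom x) this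

end Resolution

/-! ### Tensor products with free modules in coordinates. -/

section FreeTensor

variable {k A : Type u} [CommRing k] [Ring A] {N : Type u} [AddCommGroup N] [Module k N]
  [Module Aᵐᵒᵖ N] [SMulCommClass k Aᵐᵒᵖ N]

variable (k) in
/-- The map `N ⊗_A A^b → N^b`, `x ⊗ a ↦ (x aᵢ)ᵢ`. -/
def freeTensorHom (b : ℕ) : BalancedTensor k A N (Fin b → A) →ₗ[k] (Fin b → N) :=
  (balancedRel k A N (Fin b → A)).liftQ
    (TensorProduct.AlgebraTensorModule.lift
      { toFun := fun x =>
          { toFun := fun a i => MulOpposite.op (a i) • x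
            map_add' := fun a a' => funext fun i => by simp [add_smul]
            map_smul' := fun c a => funext fun i => by
              change MulOpposite.op (c • a i) • x = c • MulOpposite.op (a i) • x
              rw [MulOpposite.op_smul, smul_assoc] }
        map_add' := fun x x' => LinearMap.ext fun a => funext fun i => by simp
        map_smul' := fun c x => LinearMap.ext fun a => funext fun i => by
          simp [smul_comm] })
    (by
      refine Submodule.span_le.2 ?_
      rintro _ ⟨x, a, m, rfl⟩
      rw [SetLike.mem_coe, LinearMap.mem_ker, map_sub, sub_eq_zero]
      funext i
      simp [mul_smul])

lemma BalancedTensor.smul_tmul {M : Type u} [AddCommGroup M] [Module A M] (x : N) (a : A) (m : M) :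
    (BalancedTensor.tmul (MulOpposite.op a • x) m : BalancedTensor k A N M) =
      BalancedTensor.tmul x (a • m) :=
  (Submodule.Quotient.eq _).2 (Submodule.subset_span ⟨x, a, m, rfl⟩)

lemma BalancedTensor.add_tmul {M : Type u} [AddCommGroup M] [Module A M] (x y : N) (m : M) :
    (BalancedTensor.tmul (x + y) m : BalancedTensor k A N M) =
      BalancedTensor.tmul x m + BalancedTensor.tmul y m :=
  congrArg Submodule.Quotient.mk (TensorProduct.add_tmul x y m)

variable (k A N) in
/-- The map `N → N ⊗_A M`, `x ↦ x ⊗ m`. -/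
def BalancedTensor.mkLeft {M : Type u} [AddCommGroup M] [Module A M] (m : M) :
    N →ₗ[k] BalancedTensor k A N M where
  toFun x := BalancedTensor.tmul x m
  map_add' x y := BalancedTensor.add_tmul x y m
  map_smul' _ _ := rfl

lemma BalancedTensor.tmul_sum {M : Type u} [AddCommGroup M] [Module A M] {ι : Type*}
    (s : Finset ι) (x : N) (m : ι → M) :
    (BalancedTensor.tmul x (∑ i ∈ s, m i) : BalancedTensor k A N M) =
      ∑ i ∈ s, BalancedTensor.tmul x (m i) :=
  map_sum (AddMonoidHom.mk' (fun m : M => (BalancedTensor.tmul x m : BalancedTensor k A N M))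
    (BalancedTensor.tmul_add x)) m s

variable (k A N) in
/-- `N ⊗_A A^b ≃ N^b`. -/
def freeTensorEquiv (b : ℕ) : BalancedTensor k A N (Fin b → A) ≃ₗ[k] (Fin b → N) :=
  LinearEquiv.ofLinearMap (freeTensorHom k b)
    -- The inverse is `(xᵢ) ↦ ∑ xᵢ ⊗ eᵢ`.
    (∑ i, (BalancedTensor.mkLeft k A N (Pi.single i (1 : A))).comp (LinearMap.proj i))
    (by
      refine LinearMap.ext fun x => funext fun i => ?_
      rw [LinearMap.comp_apply, LinearMap.sum_apply, map_sum, Finset.sum_apply,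
        Finset.sum_eq_single i]
      · change MulOpposite.op ((Pi.single i (1 : A) : Fin b → A) i) • x i = x i
        simp
      · intro j _ hj
        change MulOpposite.op ((Pi.single j (1 : A) : Fin b → A) i) • x j = 0
        simp [Pi.single_eq_of_ne (Ne.symm hj)]
      · simp)
    (by
      refine BalancedTensor.hom_ext fun x a => ?_
      rw [LinearMap.comp_apply, LinearMap.sum_apply]
      change ∑ i, BalancedTensor.tmul (MulOpposite.op (a i) • x) (Pi.single i (1 : A)) =
        BalancedTensor.tmul x a
      simp only [BalancedTensor.smul_tmul]
      rw [← BalancedTensor.tmul_sum]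
      congr 1
      funext i
      simp [Finset.sum_apply, Pi.single_apply])

/-- In coordinates, a matrix acts on `N^b` by right multiplication. -/
lemma freeTensorEquiv_map {b c : ℕ} (v : Fin b → Fin c → A)
    (z : BalancedTensor k A N (Fin b → A)) (j : Fin c) :
    freeTensorEquiv k A N c (BalancedTensor.map (RingHom.id A) LinearMap.id (fun _ _ => rfl)
      (Fintype.linearCombination A v) z) j =
      ∑ i, MulOpposite.op (v i j) • freeTensorEquiv k A N b z i := by
  let F : BalancedTensor k A N (Fin b → A) →ₗ[k] (Fin c → N) :=
    (freeTensorEquiv k A N c).toLinearMap ∘ₗ BalancedTensor.map (RingHom.id A) LinearMap.id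
      (fun _ _ => rfl) (Fintype.linearCombination A v)
  let G : BalancedTensor k A N (Fin b → A) →ₗ[k] (Fin c → N) :=
    { toFun := fun z j => ∑ i, MulOpposite.op (v i j) • freeTensorEquiv k A N b z i
      map_add' := fun z z' => funext fun j => by simp [Finset.sum_add_distrib]
      map_smul' := fun a z => funext fun j => by
        simp [Finset.smul_sum, smul_comm a] }
  have : F = G := by
    refine BalancedTensor.hom_ext fun x a => funext fun j => ?_
    change MulOpposite.op ((Fintype.linearCombination A v a) j) • x =
      ∑ i, MulOpposite.op (v i j) • MulOpposite.op (a i) • x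
    simp [Fintype.linearCombination_apply, Finset.sum_apply, Finset.op_sum, Finset.sum_smul,
      mul_smul]
  exact congrFun (LinearMap.congr_fun this z) j

end FreeTensor

end

end DMod

namespace DMod

noncomputable section

set_option linter.unusedSectionVars false

/-! ### Gradings of abelian groups by subgroups. -/

section Grading

variable {N : Type*} [AddCommGroup N]

/-- A family of subgroups is a grading: every element is a sum of homogeneous elements, in a
unique way. -/
structure IsGrading (𝒩 : ℤ → AddSubgroup N) : Prop where
  span : ∀ m, m ∈ ⨆ l, 𝒩 l
  indep : ∀ x : ℤ →₀ N, (∀ l, x l ∈ 𝒩 l) → (x.sum fun _ y => y) = 0 → x = 0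

lemma exists_finsupp_of_mem_iSup {𝒩 : ℤ → AddSubgroup N} {m : N} (hm : m ∈ ⨆ l, 𝒩 l) :
    ∃ x : ℤ →₀ N, (∀ l, x l ∈ 𝒩 l) ∧ (x.sum fun _ y => y) = m := by
  induction hm using AddSubgroup.iSup_induction' with
  | hp l y hy =>
    refine ⟨Finsupp.single l y, fun l' => ?_, Finsupp.sum_single_index rfl⟩
    by_cases h : l = l'
    · subst h; simpa using hy
    · rw [Finsupp.single_eq_of_ne (Ne.symm h)]; exact zero_mem _
  | h1 => exact ⟨0, fun l => zero_mem _, Finsupp.sum_zero_index⟩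
  | hadd y z _ _ hy hz =>
    obtain ⟨x, hx, rfl⟩ := hy
    obtain ⟨x', hx', rfl⟩ := hz
    exact ⟨x + x', fun l => add_mem (hx l) (hx' l),
      Finsupp.sum_add_index' (fun _ => rfl) (fun _ _ _ => rfl)⟩

/-- If one family of subgroups spans and is contained in an independent one, they agree. -/
lemma le_of_span_of_indep {𝒩 𝒩' : ℤ → AddSubgroup N} (hle : ∀ l, 𝒩 l ≤ 𝒩' l)
    (hspan : ∀ m, m ∈ ⨆ l, 𝒩 l)
    (hindep : ∀ x : ℤ →₀ N, (∀ l, x l ∈ 𝒩' l) → (x.sum fun _ y => y) = 0 → x = 0) (l : ℤ) :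
    𝒩' l ≤ 𝒩 l := by
  intro m hm
  obtain ⟨x, hx, hxm⟩ := exists_finsupp_of_mem_iSup (hspan m)
  -- Both `x` and the one-term family `m` decompose `m` along `𝒩'`, so uniqueness forces `m = x l`,
  -- which lies in `𝒩 l`.
  have h := hindep (x - Finsupp.single l m) (fun l' => sub_mem (hle l' (hx l')) (by
    by_cases h : l = l'
    · subst h; simpa using hm
    · rw [Finsupp.single_eq_of_ne (Ne.symm h)]; exact zero_mem _)) (by
    rw [Finsupp.sum_sub_index (fun _ _ _ => rfl), hxm, Finsupp.sum_single_index rfl, sub_self])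
  have h' := DFunLike.congr_fun (sub_eq_zero.1 h) l
  rw [Finsupp.single_eq_same] at h'
  rw [← h']; exact hx l

lemma IsGrading.of_isInternal {𝒩 : ℤ → AddSubgroup N} (h : DirectSum.IsInternal 𝒩) :
    IsGrading 𝒩 where
  span m := by
    obtain ⟨x, rfl⟩ := h.2 m
    induction x using DirectSum.induction_on with
    | zero => rw [map_zero]; exact zero_mem _
    | of l y =>
      rw [DirectSum.coeAddMonoidHom_of]
      exact AddSubgroup.mem_iSup_of_mem l y.2
    | add x y hx hy => rw [map_add]; exact add_mem hx hy
  indep x hx h0 := by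
    -- The family `x` as an element of the external direct sum; its image in `N` is `0`, so
    -- injectivity of the sum map kills it.
    let y : DirectSum ℤ fun l => 𝒩 l := DirectSum.mk _ x.support fun l => ⟨x l, hx l⟩
    have hy : ∀ l, ((y l : 𝒩 l) : N) = x l := by
      intro l
      by_cases hl : l ∈ x.support
      · rw [DirectSum.mk_apply_of_mem hl]
      · rw [DirectSum.mk_apply_of_notMem hl]
        simpa using (Finsupp.notMem_support_iff.1 hl).symm
    have e : y = ∑ l ∈ x.support, DirectSum.of (fun l => 𝒩 l) l ⟨x l, hx l⟩ := by
      refine DFinsupp.ext fun m => ?_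
      apply Subtype.ext
      rw [hy, DFinsupp.finsetSum_apply, AddSubgroup.val_finsetSum]
      by_cases hm : m ∈ x.support
      · rw [Finset.sum_eq_single m]
        · exact congrArg Subtype.val (DirectSum.of_eq_same (β := fun l => 𝒩 l) m ⟨x m, hx m⟩).symm
        · intro l _ hl
          exact congrArg Subtype.val (DirectSum.of_eq_of_ne (β := fun l => 𝒩 l) l m _ (Ne.symm hl))
        · intro h'; exact absurd hm h'
      · rw [Finset.sum_eq_zero]
        · exact Finsupp.notMem_support_iff.1 hm
        · intro l hl
          have hlm : m ≠ l := by rintro rfl; exact hm hl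
          exact congrArg Subtype.val (DirectSum.of_eq_of_ne (β := fun l => 𝒩 l) l m _ hlm)
    have hy0 : y = 0 := by
      apply h.1
      rw [map_zero, e, map_sum, ← h0]
      exact Finset.sum_congr rfl fun l _ => DirectSum.coeAddMonoidHom_of _ _ _
    ext l
    rw [← hy l, hy0]; rfl

end Grading

/-! ### Homogeneous components of power series. -/

section Components

variable (k : Type u) [Field k] (n : ℕ)

/-- Finiteness makes a homogeneous component of a power series a polynomial. Degrees are integers
because operators may lower them; for `l < 0` the set is empty and the component vanishes. -/
lemma finite_degree_eq (l : ℤ) : {d : Fin n →₀ ℕ | (d.degree : ℤ) = l}.Finite :=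
  (Finsupp.finite_of_degree_le l.toNat).subset fun d hd => by
    simp only [Set.mem_ofPred_eq] at hd ⊢; omega

/-- The homogeneous component of degree `l` of a power series. -/
def hcomp (l : ℤ) : Series k n →ₗ[k] Poly k n :=
  MvPowerSeries.truncFinset k (finite_degree_eq n l).toFinset

variable {k n}

lemma coeff_hcomp (l : ℤ) (s : Series k n) (d : Fin n →₀ ℕ) :
    (hcomp k n l s).coeff d = if (d.degree : ℤ) = l then MvPowerSeries.coeff d s else 0 := by
  rw [hcomp, MvPowerSeries.coeff_truncFinset]
  simp

/-- In the convolution formula only terms whose first exponent has degree `d` survive, and for these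
the condition on the total degree becomes the condition on the second exponent. -/
lemma hcomp_mul {r : Poly k n} {d : ℕ} (hr : r.IsHomogeneous d) (l : ℤ) (s : Series k n) :
    hcomp k n (l + d) ((r : Series k n) * s) = r * hcomp k n l s := by
  ext m
  rw [coeff_hcomp, MvPowerSeries.coeff_mul, MvPolynomial.coeff_mul]
  have e : ∀ (p : Prop) [Decidable p] (t : Finset ((Fin n →₀ ℕ) × (Fin n →₀ ℕ)))
      (f : (Fin n →₀ ℕ) × (Fin n →₀ ℕ) → k),
      (if p then ∑ i ∈ t, f i else 0) = ∑ i ∈ t, if p then f i else 0 := by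
    intro p _ t f; split_ifs <;> simp
  rw [e]
  refine Finset.sum_congr rfl fun p hp => ?_
  rw [Finset.HasAntidiagonal.mem_antidiagonal] at hp
  rw [coeff_hcomp, MvPolynomial.coeff_coe, mul_ite, mul_zero]
  by_cases h : p.1.degree = d
  · congr 1
    rw [← hp, map_add, ← h]
    push_cast
    rw [add_comm, add_left_inj]
  · rw [hr.coeff_eq_zero h]; simp

lemma hcomp_pderiv (i : Fin n) (l : ℤ) (s : Series k n) :
    hcomp k n (l + (-1)) (MvPowerSeries.pderiv k i s) = MvPolynomial.pderiv i (hcomp k n l s) := by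
  ext m
  rw [coeff_hcomp, MvPowerSeries.coeff_pderiv, MvPolynomial.coeff_pderiv, coeff_hcomp, ite_mul,
    zero_mul]
  congr 1
  rw [map_add, Finsupp.degree_single]
  simp only [eq_iff_iff]
  push_cast
  omega

lemma hcomp_hcomp_same (l : ℤ) (s : Series k n) :
    hcomp k n l (hcomp k n l s : Poly k n) = hcomp k n l s := by
  ext m
  rw [coeff_hcomp, MvPolynomial.coeff_coe, coeff_hcomp]
  split_ifs <;> rfl

lemma hcomp_hcomp_of_ne {l l' : ℤ} (h : l ≠ l') (s : Series k n) :
    hcomp k n l (hcomp k n l' s : Poly k n) = 0 := by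
  ext m
  rw [coeff_hcomp, MvPolynomial.coeff_coe, coeff_hcomp]
  split_ifs with h1 h2
  · exact absurd (h1.symm.trans h2) h
  · simp
  · simp

lemma hcomp_ext {s : Series k n} (h : ∀ l, hcomp k n l s = 0) : s = 0 := by
  ext m
  have := congrArg (MvPolynomial.coeff m) (h m.degree)
  rw [coeff_hcomp, if_pos rfl] at this
  simpa using this

/-- Power series are the full product of their homogeneous components: the coefficient at `d` is
taken from the series prescribed in degree `|d|`. -/
lemma exists_hcomp_eq (r : ℤ → Series k n) : ∃ s, ∀ l, hcomp k n l s = hcomp k n l (r l) := by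
  let s : Series k n := fun d => MvPowerSeries.coeff d (r d.degree)
  have hs : ∀ d, MvPowerSeries.coeff d s = MvPowerSeries.coeff d (r d.degree) := fun d => rfl
  refine ⟨s, fun l => ?_⟩
  clear_value s
  ext m
  rw [coeff_hcomp, coeff_hcomp, hs]
  split_ifs with h
  · rw [h]
  · rfl

/-- Allowing any sufficiently large `t` lets several coordinates share one finite set of degrees
later. -/
lemma sum_hcomp (r : Poly k n) {t : Finset ℤ} (ht : ∀ d ∈ r.support, (d.degree : ℤ) ∈ t) :
    ∑ l ∈ t, hcomp k n l (r : Series k n) = r := by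
  ext m
  rw [MvPolynomial.coeff_sum]
  simp only [coeff_hcomp, MvPolynomial.coeff_coe]
  rw [Finset.sum_ite_eq]
  split_ifs with h
  · rfl
  · by_contra h'
    exact h (ht m (MvPolynomial.mem_support_iff.2 (Ne.symm h')))

end Components

/-! ### The grading of the ring of differential operators. -/

section GradedOperators

variable {k : Type u} [Field k] {n : ℕ}

lemma finsupp_induction_single {p : (Fin n →₀ ℕ) → Prop} (h0 : p 0)
    (h1 : ∀ i α, p α → p (Finsupp.single i 1 + α)) (α : Fin n →₀ ℕ) : p α := by
  induction hs : α.degree generalizing α with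
  | zero =>
    obtain rfl := (Finsupp.degree_eq_zero_iff α).1 hs
    exact h0
  | succ s ih =>
    have : α ≠ 0 := by rintro rfl; simp at hs
    obtain ⟨i, hi⟩ := Finsupp.ne_iff.1 this
    have hle : Finsupp.single i 1 ≤ α := by
      rw [Finsupp.single_le_iff]; simp at hi; omega
    obtain ⟨γ, rfl⟩ := exists_add_of_le hle
    rw [map_add, Finsupp.degree_single] at hs
    exact h1 i γ (ih γ (by omega))

lemma pdPow_single_add {A : Type u} [CommRing A] [Algebra k A] [Coordinates k A n]
    (i : Fin n) (α : Fin n →₀ ℕ) :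
    pdPow k A (Finsupp.single i 1 + α) = pd k A i * pdPow k A α := by
  rw [pdPow, pdPow, dpow_add, dpow_single]

lemma pdPow_zero {A : Type u} [CommRing A] [Algebra k A] [Coordinates k A n] :
    pdPow k A 0 = 1 := dpow_zero

variable (k n) in
/-- The operators that are homogeneous of degree `e`: sums of operators `r ∂ ^ α` with `r`
homogeneous of degree `e + |α|`. -/
def gradeD (e : ℤ) : AddSubgroup (D k n) :=
  AddSubgroup.closure {P | ∃ (r : Poly k n) (α : Fin n →₀ ℕ) (d : ℕ), r.IsHomogeneous d ∧
    (d : ℤ) - α.degree = e ∧ P = DiffOp.ofFun r * pdPow k (Poly k n) α}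

lemma gradeD_induction {q : ℤ → D k n → Prop} (hzero : ∀ e, q e 0)
    (hr : ∀ (r : Poly k n) (d : ℕ), r.IsHomogeneous d → q d (DiffOp.ofFun r))
    (hpd : ∀ i, q (-1) (pd k (Poly k n) i))
    (hadd : ∀ e P Q, q e P → q e Q → q e (P + Q))
    (hmul : ∀ e e' P Q, q e P → q e' Q → q (e + e') (P * Q)) {e : ℤ} {P : D k n}
    (hP : P ∈ gradeD k n e) : q e P := by
  have hpow : ∀ α : Fin n →₀ ℕ, q (-(α.degree : ℤ)) (pdPow k (Poly k n) α) := by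
    intro α
    induction α using finsupp_induction_single with
    | h0 => simpa [pdPow_zero] using hr 1 0 (MvPolynomial.isHomogeneous_one _ _)
    | h1 i α ih =>
      rw [pdPow_single_add, map_add, Finsupp.degree_single]
      convert hmul _ _ _ _ (hpd i) ih using 1
      push_cast; ring
  induction hP using AddSubgroup.closure_induction with
  | mem P hP =>
    obtain ⟨r, α, d, hd, rfl, rfl⟩ := hP
    rw [sub_eq_add_neg]
    exact hmul _ _ _ _ (hr r d hd) (hpow α)
  | zero => exact hzero _
  | add P Q _ _ hP hQ => exact hadd _ _ _ hP hQ
  | neg P _ hP =>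
    -- Negation is multiplication by the constant `-1`, of degree `0`, so it needs no separate
    -- hypothesis.
    have := hmul _ _ _ _ (hr (-1) 0 (MvPolynomial.isHomogeneous_one _ _).neg) hP
    simpa using this

variable [CharZero k]

lemma toHat_ofFun (r : Poly k n) : toHat k n (DiffOp.ofFun r) = DiffOp.ofFun (r : Series k n) :=
  DiffOp.lift_ofFun _ _ _ _ r

lemma toHat_pd (i : Fin n) : toHat k n (pd k (Poly k n) i) = pd k (Series k n) i :=
  DiffOp.lift_pd _ _ _ _ i

variable (k n) in
/-- The operators that shift homogeneous components of power series by `e`. -/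
def shiftD (e : ℤ) : AddSubgroup (D k n) where
  carrier := {P | ∀ (l : ℤ) (s : Series k n),
    hcomp k n (l + e) (toHat k n P • s) = P • hcomp k n l s}
  zero_mem' l s := by simp
  add_mem' hP hQ l s := by
    rw [map_add, add_smul, map_add, hP, hQ, add_smul]
  neg_mem' hP l s := by
    rw [map_neg, neg_smul, map_neg, hP, neg_smul]

lemma mul_mem_shiftD {e e' : ℤ} {P Q : D k n} (hP : P ∈ shiftD k n e) (hQ : Q ∈ shiftD k n e') :
    P * Q ∈ shiftD k n (e + e') := by
  intro l s
  rw [map_mul, mul_smul, mul_smul, ← hQ l s, ← hP, add_comm e, add_assoc]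

lemma gradeD_le_shiftD (e : ℤ) : gradeD k n e ≤ shiftD k n e := by
  intro P hP
  refine gradeD_induction (q := fun e P => P ∈ shiftD k n e) (fun _ => zero_mem _) ?_ ?_
    (fun e P Q hP hQ => add_mem hP hQ) (fun _ _ _ _ hP hQ => mul_mem_shiftD hP hQ) hP
  · intro r d hr l s
    rw [toHat_ofFun]
    exact hcomp_mul hr l s
  · intro i l s
    rw [toHat_pd]
    exact hcomp_pderiv i l s

/-- An operator of degree `l` sends polynomials of degree `d` to degree `d + l`. Applying the sum to
a homogeneous polynomial of degree `d` and reading off degree `d + m` therefore isolates `x m`, and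
homogeneous polynomials span `R`. -/
lemma shiftD_indep (x : ℤ →₀ D k n) (hx : ∀ l, x l ∈ shiftD k n l)
    (h0 : (x.sum fun _ y => y) = 0) : x = 0 := by
  ext m
  refine DiffOp.ext (LinearMap.ext fun r => ?_)
  change x m • r = 0
  have key : ∀ d, x m • hcomp k n d (r : Series k n) = 0 := by
    intro d
    let s : Series k n := (hcomp k n d (r : Series k n) : Poly k n)
    have h1 : hcomp k n (d + m) (toHat k n (x.sum fun _ y => y) • s) = 0 := by
      rw [h0, map_zero, zero_smul, map_zero]
    rw [Finsupp.sum, map_sum, Finset.sum_smul, map_sum, Finset.sum_eq_single m] at h1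
    · rw [hx m, hcomp_hcomp_same] at h1
      exact h1
    · intro l _ hl
      have := hx l (d + m - l) s
      rw [sub_add_cancel] at this
      rw [this, hcomp_hcomp_of_ne (by omega), smul_zero]
    · intro hm
      rw [Finsupp.notMem_support_iff.1 hm, map_zero, zero_smul, map_zero]
  rw [← sum_hcomp r (t := r.support.image fun d => (d.degree : ℤ))
    (fun d hd => Finset.mem_image_of_mem _ hd), Finset.smul_sum]
  exact Finset.sum_eq_zero fun d _ => key d

/-- Each coefficient of the normal form is split into its homogeneous components. -/
lemma gradeD_span (P : D k n) : P ∈ ⨆ l, gradeD k n l := by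
  obtain ⟨f, rfl⟩ := normalEquiv.surjective P
  induction f using Finsupp.induction_linear with
  | zero => rw [map_zero]; exact zero_mem _
  | add f g hf hg => rw [map_add]; exact add_mem hf hg
  | single α a =>
    rw [normalEquiv_single, ← MvPolynomial.sum_homogeneousComponent a, map_sum, Finset.sum_mul]
    refine sum_mem fun d _ => AddSubgroup.mem_iSup_of_mem ((d : ℤ) - α.degree)
      (AddSubgroup.subset_closure ⟨_, α, d, ?_, rfl, rfl⟩)
    exact MvPolynomial.homogeneousComponent_isHomogeneous d a

/-- The two descriptions of homogeneity agree: spanning is visible for `gradeD`, while independence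
and closure under products are visible for `shiftD`. -/
lemma shiftD_le_gradeD (e : ℤ) : shiftD k n e ≤ gradeD k n e :=
  le_of_span_of_indep gradeD_le_shiftD gradeD_span shiftD_indep e

lemma isGrading_gradeD : IsGrading (gradeD k n) where
  span := gradeD_span
  indep x hx := shiftD_indep x fun l => gradeD_le_shiftD l (hx l)

/-- Passing through `shiftD` avoids rewriting a product of normal forms in normal form. -/
lemma mul_mem_gradeD {e e' : ℤ} {P Q : D k n} (hP : P ∈ gradeD k n e) (hQ : Q ∈ gradeD k n e') :
    P * Q ∈ gradeD k n (e + e') :=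
  shiftD_le_gradeD _ (mul_mem_shiftD (gradeD_le_shiftD _ hP) (gradeD_le_shiftD _ hQ))

variable (k n) in
/-- `hcomp` as a map `R̂^τ → R^τ`. -/
def hcompT (l : ℤ) : Transpose (Series k n) →ₗ[k] Transpose (Poly k n) := hcomp k n l

/-- The right action of homogeneous operators on power series shifts homogeneous components. -/
lemma hcomp_op_smul {e : ℤ} {P : D k n} (hP : P ∈ gradeD k n e) (l : ℤ)
    (s : Transpose (Series k n)) :
    hcompT k n (l + e) (MulOpposite.op (toHat k n P) • s) = MulOpposite.op P • hcompT k n l s := by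
  revert l s
  refine gradeD_induction (q := fun e P => ∀ (l : ℤ) (s : Transpose (Series k n)),
    hcompT k n (l + e) (MulOpposite.op (toHat k n P) • s) = MulOpposite.op P • hcompT k n l s)
      ?_ ?_ ?_ ?_ ?_ hP
  · intro e l s
    rw [map_zero, MulOpposite.op_zero, MulOpposite.op_zero, zero_smul, zero_smul, map_zero]
  · intro r d hr l s
    have h1 : tau (DiffOp.ofFun r : D k n) = MulOpposite.op (DiffOp.ofFun r) :=
      DiffOp.lift_ofFun _ _ _ _ r
    have h2 : tau (DiffOp.ofFun (r : Series k n) : DHat k n) =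
        MulOpposite.op (DiffOp.ofFun (r : Series k n)) := DiffOp.lift_ofFun _ _ _ _ _
    rw [toHat_ofFun]
    change hcomp k n (l + d) ((tau (DiffOp.ofFun (r : Series k n) : DHat k n)).unop.toEnd s) =
      (tau (DiffOp.ofFun r : D k n)).unop.toEnd (hcomp k n l s)
    rw [h1, h2]
    exact hcomp_mul hr l s
  · intro i l s
    have h1 : tau (pd k (Poly k n) i) = MulOpposite.op (-pd k (Poly k n) i) :=
      DiffOp.lift_pd _ _ _ _ i
    have h2 : tau (pd k (Series k n) i) = MulOpposite.op (-pd k (Series k n) i) :=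
      DiffOp.lift_pd _ _ _ _ i
    rw [toHat_pd]
    change hcomp k n (l + -1) ((tau (pd k (Series k n) i)).unop.toEnd s) =
      (tau (pd k (Poly k n) i)).unop.toEnd (hcomp k n l s)
    rw [h1, h2]
    change hcomp k n (l + -1) (-MvPowerSeries.pderiv k i s) = -MvPolynomial.pderiv i (hcomp k n l s)
    exact (map_neg (hcomp k n (l + -1)) _).trans (congrArg _ (hcomp_pderiv i l s))
  · intro e P Q hP hQ l s
    rw [map_add, MulOpposite.op_add, MulOpposite.op_add, add_smul, add_smul, ← hP, ← hQ, map_add]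
  -- For a right action `s · (P Q) = (s · P) · Q`, so `P` shifts first; hence the order of `e` and
  -- `e'`, opposite to that in `mul_mem_shiftD`.
  · intro e e' P Q hP hQ l s
    rw [map_mul, MulOpposite.op_mul, MulOpposite.op_mul, mul_smul, mul_smul, ← hP, ← hQ,
      add_assoc]

end GradedOperators

end

end DMod

namespace DMod

noncomputable section

set_option linter.unusedSectionVars false

/-! ### Graded free modules and homogeneous generators. -/

section GradedFree

variable {k : Type u} [Field k] [CharZero k] {n : ℕ} {b : ℕ}

/-- The grading of the free module `𝒟^b` whose `i`-th basis vector has degree `deg i`. -/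
def freeGrade (deg : Fin b → ℤ) (l : ℤ) : AddSubgroup (Fin b → D k n) where
  carrier := {v | ∀ i, v i ∈ gradeD k n (l - deg i)}
  zero_mem' _ := zero_mem _
  add_mem' hv hw i := add_mem (hv i) (hw i)
  neg_mem' hv i := neg_mem (hv i)

/-- Both properties are checked coordinate by coordinate, where the grading is that of `𝒟` shifted
by `deg i`. -/
lemma isGrading_freeGrade (deg : Fin b → ℤ) :
    IsGrading (freeGrade deg : ℤ → AddSubgroup (Fin b → D k n)) where
  span v := by
    rw [← Finset.univ_sum_single v]
    refine sum_mem fun i _ => ?_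
    generalize v i = P
    induction gradeD_span P using AddSubgroup.iSup_induction' with
    | hp l y hy =>
      refine AddSubgroup.mem_iSup_of_mem (l + deg i) fun j => ?_
      by_cases h : j = i
      · subst h; simpa using hy
      · rw [Pi.single_eq_of_ne h]; exact zero_mem _
    | h1 => rw [Pi.single_zero]; exact zero_mem _
    | hadd y z _ _ hy hz => rw [Pi.single_add]; exact add_mem hy hz
  indep x hx h0 := by
    ext l i
    -- The `i`-th coordinates, reindexed by their degree in `𝒟`.
    let y : ℤ →₀ D k n := (x.mapRange (fun v => v i) rfl).mapDomain (fun l => l - deg i)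
    have hinj : Function.Injective fun l : ℤ => l - deg i := sub_left_injective
    have hy : ∀ l, y l ∈ gradeD k n l := by
      intro l
      have := Finsupp.mapDomain_apply hinj (x.mapRange (fun v => v i) rfl) (l + deg i)
      rw [add_sub_cancel_right] at this
      rw [this, Finsupp.mapRange_apply]
      simpa using hx (l + deg i) i
    have hy0 : (y.sum fun _ z => z) = 0 := by
      rw [Finsupp.sum_mapDomain_index (fun _ => rfl) (fun _ _ _ => rfl),
        Finsupp.sum_mapRange_index (fun _ => rfl)]
      have := congrFun h0 i
      rw [Finsupp.sum, Finset.sum_apply] at this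
      exact this
    have := DFunLike.congr_fun (isGrading_gradeD.indep y hy hy0) (l - deg i)
    rw [Finsupp.mapDomain_apply hinj] at this
    simpa using this

variable {N : Type u} [AddCommGroup N] [Module (D k n) N]

variable (k n) in
/-- Homogeneous operators act on a graded module by shifting degrees. -/
def IsGradedAction (𝒩 : ℤ → AddSubgroup N) : Prop :=
  ∀ e l, ∀ P ∈ gradeD k n e, ∀ m ∈ 𝒩 l, P • m ∈ 𝒩 (e + l)

lemma isGradedAction_freeGrade (deg : Fin b → ℤ) :
    IsGradedAction k n (freeGrade deg : ℤ → AddSubgroup (Fin b → D k n)) := by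
  intro e l P hP v hv i
  rw [add_sub_assoc]
  exact mul_mem_gradeD hP (hv i)

lemma IsGradedDModule.isGradedAction {ℳ : ℤ → AddSubgroup N} (h : IsGradedDModule k n ℳ) :
    IsGradedAction k n ℳ := by
  intro e l P hP
  revert l
  refine gradeD_induction (q := fun e P => ∀ l, ∀ m ∈ ℳ l, P • m ∈ ℳ (e + l)) ?_ ?_ ?_ ?_ ?_ hP
  · intro e l m _; rw [zero_smul]; exact zero_mem _
  · intro r d hr l m hm; exact h.poly_smul d l r m hr hm
  · intro i l m hm
    rw [neg_add_eq_sub]; exact h.pd_smul i l m hm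
  · intro e P Q hP hQ l m hm
    rw [add_smul]; exact add_mem (hP l m hm) (hQ l m hm)
  · intro e e' P Q hP hQ l m hm
    rw [mul_smul, add_assoc]; exact hP _ _ (hQ l m hm)

lemma linearCombination_mem {𝒩 : ℤ → AddSubgroup N} (h𝒩 : IsGradedAction k n 𝒩)
    {deg : Fin b → ℤ} {v : Fin b → N} (hv : ∀ i, v i ∈ 𝒩 (deg i)) {l : ℤ} {a : Fin b → D k n}
    (ha : a ∈ freeGrade deg l) : Fintype.linearCombination (D k n) v a ∈ 𝒩 l := by
  rw [Fintype.linearCombination_apply]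
  refine sum_mem fun i _ => ?_
  have := h𝒩 _ _ _ (ha i) _ (hv i)
  rwa [sub_add_cancel] at this

/-- The kernel of a homogeneous map is generated by homogeneous elements. -/
lemma ker_le_span_homogeneous {𝒩 : ℤ → AddSubgroup N} (hg : IsGrading 𝒩)
    (h𝒩 : IsGradedAction k n 𝒩) {deg : Fin b → ℤ} {v : Fin b → N}
    (hv : ∀ i, v i ∈ 𝒩 (deg i)) :
    LinearMap.ker (Fintype.linearCombination (D k n) v) ≤
      Submodule.span (D k n) {a | a ∈ LinearMap.ker (Fintype.linearCombination (D k n) v) ∧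
        ∃ l, a ∈ freeGrade deg l} := by
  intro a ha
  obtain ⟨x, hx, rfl⟩ := exists_finsupp_of_mem_iSup ((isGrading_freeGrade deg).span a)
  let f := Fintype.linearCombination (D k n) v
  -- The images of the components of `a` are homogeneous of distinct degrees and sum to `0`, so
  -- every component of `a` lies in the kernel.
  have h0 := hg.indep (x.mapRange f (map_zero f))
    (fun l => by
      rw [Finsupp.mapRange_apply]
      exact linearCombination_mem h𝒩 hv (hx l))
    (by
      rw [Finsupp.sum_mapRange_index (fun _ => rfl)]
      rw [LinearMap.mem_ker, Finsupp.sum, map_sum] at ha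
      exact ha)
  refine Submodule.sum_mem _ fun l _ => Submodule.subset_span ⟨?_, l, hx l⟩
  have := DFunLike.congr_fun h0 l
  rwa [Finsupp.mapRange_apply] at this

/-- A finitely generated submodule spanned by homogeneous elements is the image of a homogeneous
map from a free module of finite rank. -/
lemma exists_homogeneous_generators {𝒩 : ℤ → AddSubgroup N} {K : Submodule (D k n) N} (hK : K.FG)
    (hspan : K ≤ Submodule.span (D k n) {a | a ∈ K ∧ ∃ l, a ∈ 𝒩 l}) :
    ∃ (b : ℕ) (deg : Fin b → ℤ) (v : Fin b → N), (∀ i, v i ∈ 𝒩 (deg i)) ∧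
      LinearMap.range (Fintype.linearCombination (D k n) v) = K := by
  have e : Submodule.span (D k n) {a | a ∈ K ∧ ∃ l, a ∈ 𝒩 l} = K :=
    le_antisymm (Submodule.span_le.2 fun a ha => ha.1) hspan
  have hfg : (Submodule.span (D k n) {a | a ∈ K ∧ ∃ l, a ∈ 𝒩 l}).FG := by rwa [e]
  -- Finitely many generators can be picked from the spanning set itself, so they remain
  -- homogeneous.
  obtain ⟨t, ht, hts⟩ := (Submodule.fg_span_iff_fg_span_finset_subset _).1 hfg
  let w : Fin t.card → N := fun i => (t.equivFin.symm i : N)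
  have hw : ∀ i, ∃ l, w i ∈ 𝒩 l := fun i => (ht (t.equivFin.symm i).2).2
  choose deg hdeg using hw
  refine ⟨t.card, deg, w, hdeg, ?_⟩
  rw [Fintype.range_linearCombination, ← e, hts]
  congr 1
  ext y
  constructor
  · rintro ⟨i, rfl⟩; exact (t.equivFin.symm i).2
  · intro hy; exact ⟨t.equivFin ⟨y, hy⟩, by simp [w]⟩

end GradedFree

/-! ### Graded free resolutions of finite rank. -/

section GradedResolution

variable (k : Type u) [Field k] [CharZero k] (n : ℕ) [IsNoetherianRing (D k n)]

/-- A homogeneous matrix. -/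
structure HomogeneousMatrix where
  rows : ℕ
  cols : ℕ
  rowDeg : Fin rows → ℤ
  colDeg : Fin cols → ℤ
  v : Fin rows → Fin cols → D k n
  homogeneous : ∀ i, v i ∈ freeGrade colDeg (rowDeg i)

variable {k n}

/-- The relations between the rows form a submodule of a finite free module, finitely generated
because `𝒟` is Noetherian, and spanned by homogeneous relations because the matrix is homogeneous.
-/
lemma HomogeneousMatrix.exists_next (s : HomogeneousMatrix k n) :
    ∃ (b : ℕ) (deg : Fin b → ℤ) (v : Fin b → Fin s.rows → D k n),
      (∀ i, v i ∈ freeGrade s.rowDeg (deg i)) ∧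
      LinearMap.range (Fintype.linearCombination (D k n) v) =
        LinearMap.ker (Fintype.linearCombination (D k n) s.v) :=
  exists_homogeneous_generators (IsNoetherian.noetherian _)
    (ker_le_span_homogeneous (isGrading_freeGrade s.colDeg) (isGradedAction_freeGrade s.colDeg)
      s.homogeneous)

/-- A homogeneous matrix whose rows generate the relations between the rows of a given one. -/
def HomogeneousMatrix.next (s : HomogeneousMatrix k n) : HomogeneousMatrix k n where
  rows := s.exists_next.choose
  cols := s.rows
  rowDeg := s.exists_next.choose_spec.choose
  colDeg := s.rowDeg
  v := s.exists_next.choose_spec.choose_spec.choose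
  homogeneous := s.exists_next.choose_spec.choose_spec.choose_spec.1

lemma HomogeneousMatrix.next_range (s : HomogeneousMatrix k n) :
    LinearMap.range (Fintype.linearCombination (D k n) s.next.v) =
      LinearMap.ker (Fintype.linearCombination (D k n) s.v) :=
  s.exists_next.choose_spec.choose_spec.choose_spec.2

/-- A finitely generated graded `𝒟`-module has a resolution by graded free modules of finite
rank. -/
theorem exists_graded_resolution {M : Type u} [AddCommGroup M] [Module (D k n) M]
    [Module.Finite (D k n) M] {ℳ : ℤ → AddSubgroup M} (hℳ : IsGradedDModule k n ℳ) :
    ∃ (b : ℕ → ℕ) (deg : ∀ j, Fin (b j) → ℤ) (v : ∀ j, Fin (b (j + 1)) → Fin (b j) → D k n)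
      (w : Fin (b 0) → M),
      (∀ j i, v j i ∈ freeGrade (deg j) (deg (j + 1) i)) ∧
      (∀ j, Function.Exact (Fintype.linearCombination (D k n) (v (j + 1)))
        (Fintype.linearCombination (D k n) (v j))) ∧
      Function.Exact (Fintype.linearCombination (D k n) (v 0))
        (Fintype.linearCombination (D k n) w) ∧
      Function.Surjective (Fintype.linearCombination (D k n) w) := by
  have hg := IsGrading.of_isInternal hℳ.isInternal
  obtain ⟨b₀, deg₀, w, hw, hwr⟩ := exists_homogeneous_generators (𝒩 := ℳ)
    (Module.Finite.fg_top (R := D k n) (M := M)) (by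
      intro m _
      obtain ⟨x, hx, rfl⟩ := exists_finsupp_of_mem_iSup (hg.span m)
      exact Submodule.sum_mem _ fun l _ => Submodule.subset_span ⟨trivial, l, hx l⟩)
  obtain ⟨b₁, deg₁, v₀, hv₀, hvr⟩ := exists_homogeneous_generators (IsNoetherian.noetherian _)
    (ker_le_span_homogeneous hg hℳ.isGradedAction hw)
  -- The number of columns of `t.next` is by definition the number of rows of `t`, so consecutive
  -- matrices compose and the ranks can be read off as column counts.
  let s : ℕ → HomogeneousMatrix k n := fun j =>
    Nat.rec ⟨b₁, b₀, deg₁, deg₀, v₀, hv₀⟩ (fun _ t => t.next) j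
  refine ⟨fun j => (s j).cols, fun j => (s j).colDeg, fun j => (s j).v, w,
    fun j => (s j).homogeneous, fun j => ?_, ?_, ?_⟩
  · rw [LinearMap.exact_iff]
    exact (s j).next_range.symm
  · rw [LinearMap.exact_iff]
    exact hvr.symm
  · rw [← LinearMap.range_eq_top]
    exact hwr

end GradedResolution

end

end DMod

namespace DMod

noncomputable section

set_option linter.unusedSectionVars false

open scoped TensorProduct

/-! ### Exactness of completion. -/

section Flat

variable (k : Type u) [Field k] (n : ℕ)

/-- Power series form an adic completion of the Noetherian ring `R`, and such completions are flat.
-/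
instance series_flat : Module.Flat (Poly k n) (Series k n) :=
  Module.Flat.of_linearEquiv (MvPowerSeries.toAdicCompletionAlgEquiv (Fin n) k).toLinearEquiv

variable {M M' M'' : Type u} [AddCommGroup M] [Module (D k n) M] [AddCommGroup M']
  [Module (D k n) M'] [AddCommGroup M''] [Module (D k n) M'']

attribute [local instance] asPolyModule

/-- A `𝒟`-linear map regarded as an `R`-linear map. -/
def asPolyLinear (f : M →ₗ[D k n] M') : M →ₗ[Poly k n] M' where
  toFun := f
  map_add' := map_add f
  map_smul' r m := map_smul f (DiffOp.ofFun r : D k n) m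

/-- The map `M̂ → M̂'` induced by a `𝒟`-linear map `M → M'`. -/
def Completion.map (f : M →ₗ[D k n] M') : Completion k n M →+ Completion k n M' :=
  (LinearMap.lTensor (Series k n) (asPolyLinear k n f)).toAddMonoidHom

lemma Completion.map_exact {f : M →ₗ[D k n] M'} {g : M' →ₗ[D k n] M''}
    (h : Function.Exact f g) : Function.Exact (Completion.map k n f) (Completion.map k n g) := by
  have h' : Function.Exact (asPolyLinear k n f) (asPolyLinear k n g) := h
  exact Module.Flat.lTensor_exact (Series k n) h'

lemma Completion.map_surjective {f : M →ₗ[D k n] M'} (h : Function.Surjective f) :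
    Function.Surjective (Completion.map k n f) := by
  have h' : Function.Surjective (asPolyLinear k n f) := h
  exact LinearMap.lTensor_surjective (Series k n) h'

end Flat

/-! ### Completion of free modules and of free resolutions. -/

section FreeCompletion

variable {k : Type u} [Field k] [CharZero k] {n : ℕ}

lemma toHat_pdPow (α : Fin n →₀ ℕ) :
    toHat k n (pdPow k (Poly k n) α) = pdPow k (Series k n) α := by
  induction α using finsupp_induction_single with
  | h0 => rw [pdPow_zero, pdPow_zero, map_one]
  | h1 i α ih => rw [pdPow_single_add, pdPow_single_add, map_mul, ih, toHat_pd]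

attribute [local instance] asPolyModule in
variable (k n) in
/-- The map `R̂ ⊗_R 𝒟^b → 𝒟̂^b`, `s ⊗ a ↦ (s aᵢ)ᵢ`. -/
def freeCompletionHom (b : ℕ) : Completion k n (Fin b → D k n) →+ (Fin b → DHat k n) :=
  TensorProduct.liftAddHom (R := Poly k n) (M := Series k n) (N := Fin b → D k n)
    (AddMonoidHom.mk' (fun s => AddMonoidHom.mk'
        (fun a i => (DiffOp.ofFun s : DHat k n) * toHat k n (a i))
        (fun a a' => funext fun i => by
          rw [Pi.add_apply, map_add, mul_add]; rfl))
      (fun s s' => AddMonoidHom.ext fun a => funext fun i => by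
        change (DiffOp.ofFun (s + s') : DHat k n) * toHat k n (a i) = _ + _
        rw [map_add, add_mul]; rfl))
    (fun r s a => funext fun i => by
      change (DiffOp.ofFun ((r : Series k n) * s) : DHat k n) * toHat k n (a i) =
        (DiffOp.ofFun s : DHat k n) * toHat k n (DiffOp.ofFun r * a i)
      rw [map_mul (toHat k n), toHat_ofFun, ← mul_assoc, ← map_mul, mul_comm s])

lemma freeCompletionHom_tmul (b : ℕ) (s : Series k n) (a : Fin b → D k n) (i : Fin b) :
    freeCompletionHom k n b (Completion.tmul k n s a) i =
      (DiffOp.ofFun s : DHat k n) * toHat k n (a i) := rfl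

/-- The additive map `∑ a_α ∂ ^ α ↦ ∑ f_α(a_α)`. -/
def normalHom {A : Type u} [CommRing A] [Algebra k A] [Coordinates k A n] {N : Type*}
    [AddCommGroup N] (f : (Fin n →₀ ℕ) → A →+ N) : DiffOp k A →+ N :=
  (Finsupp.liftAddHom f).comp normalEquiv.symm.toAddMonoidHom

lemma normalHom_apply {A : Type u} [CommRing A] [Algebra k A] [Coordinates k A n] {N : Type*}
    [AddCommGroup N] (f : (Fin n →₀ ℕ) → A →+ N) (a : A) (α : Fin n →₀ ℕ) :
    normalHom f (DiffOp.ofFun a * pdPow k A α) = f α a := by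
  rw [← normalEquiv_single]
  simp [normalHom]

variable (k n) in
/-- The map `𝒟̂^b → R̂ ⊗_R 𝒟^b` inverse to `freeCompletionHom`. -/
def freeCompletionInv (b : ℕ) : (Fin b → DHat k n) →+ Completion k n (Fin b → D k n) :=
  ∑ i, (normalHom fun α => AddMonoidHom.mk'
      (fun s => Completion.tmul k n s (Pi.single i (pdPow k (Poly k n) α) : Fin b → D k n))
      (fun s s' => Completion.add_tmul k n s s' _)).comp (Pi.evalAddMonoidHom _ i)

lemma freeCompletionInv_single (b : ℕ) (i : Fin b) (s : Series k n) (α : Fin n →₀ ℕ) :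
    freeCompletionInv k n b (Pi.single i (DiffOp.ofFun s * pdPow k (Series k n) α)) =
      Completion.tmul k n s (Pi.single i (pdPow k (Poly k n) α)) := by
  rw [freeCompletionInv, AddMonoidHom.finsetSum_apply, Finset.sum_eq_single i]
  · rw [AddMonoidHom.comp_apply, Pi.evalAddMonoidHom_apply, Pi.single_eq_same, normalHom_apply]
    rfl
  · intro j _ hj
    rw [AddMonoidHom.comp_apply, Pi.evalAddMonoidHom_apply, Pi.single_eq_of_ne hj, map_zero]
  · simp

variable {A : Type u} [CommRing A] [Algebra k A] [Coordinates k A n]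

/-- Additive maps out of `𝒟^b` are determined by their values on the vectors `r ∂ ^ α eᵢ`. -/
lemma pi_addHom_ext {b : ℕ} {N : Type*} [AddCommGroup N] {f g : (Fin b → DiffOp k A) →+ N}
    (h : ∀ i (a : A) α, f (Pi.single i (DiffOp.ofFun a * pdPow k A α)) =
      g (Pi.single i (DiffOp.ofFun a * pdPow k A α))) : f = g := by
  refine AddMonoidHom.functions_ext' _ _ _ fun i => ?_
  refine AddMonoidHom.ext fun P => ?_
  obtain ⟨F, rfl⟩ := normalEquiv.surjective P
  have : (f.comp (AddMonoidHom.single _ i)).comp normalEquiv.toAddMonoidHom =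
      (g.comp (AddMonoidHom.single _ i)).comp normalEquiv.toAddMonoidHom := by
    refine Finsupp.addHom_ext fun α a => ?_
    change f (Pi.single i (normalEquiv _)) = g (Pi.single i (normalEquiv _))
    rw [normalEquiv_single]
    exact h i a α
  exact DFunLike.congr_fun this F

variable (k n) in
/-- `R̂ ⊗_R 𝒟^b ≃ 𝒟̂^b`. -/
def freeCompletionEquiv (b : ℕ) : Completion k n (Fin b → D k n) ≃+ (Fin b → DHat k n) :=
  AddMonoidHom.toAddEquiv (freeCompletionHom k n b) (freeCompletionInv k n b)
    (by
      refine Completion.addHom_ext k n fun s a => ?_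
      have : ((freeCompletionInv k n b).comp (freeCompletionHom k n b)).comp
          (AddMonoidHom.mk' (fun a : Fin b → D k n => Completion.tmul k n s a)
            (Completion.tmul_add k n s)) =
          AddMonoidHom.mk' (fun a : Fin b → D k n => Completion.tmul k n s a)
            (Completion.tmul_add k n s) := by
        refine pi_addHom_ext fun i r α => ?_
        change freeCompletionInv k n b (freeCompletionHom k n b (Completion.tmul k n s _)) =
          Completion.tmul k n s _
        -- The polynomial coefficient `r` is moved across the tensor sign into the series, leaving a
        -- vector on which the inverse is given by its defining formula.
        have e1 : (Pi.single i (DiffOp.ofFun r * pdPow k (Poly k n) α) : Fin b → D k n) =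
            (DiffOp.ofFun r : D k n) • Pi.single i (pdPow k (Poly k n) α) := by
          rw [← Pi.single_smul, smul_eq_mul]
        have e2 : freeCompletionHom k n b (Completion.tmul k n ((r : Series k n) * s)
            (Pi.single i (pdPow k (Poly k n) α))) =
            Pi.single i (DiffOp.ofFun ((r : Series k n) * s) * pdPow k (Series k n) α) := by
          funext j
          rw [freeCompletionHom_tmul]
          by_cases h : j = i
          · subst h; rw [Pi.single_eq_same, Pi.single_eq_same, toHat_pdPow]
          · rw [Pi.single_eq_of_ne h, Pi.single_eq_of_ne h, map_zero, mul_zero]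
        rw [e1, Completion.tmul_ofFun, e2, freeCompletionInv_single]
      exact DFunLike.congr_fun this a)
    (by
      refine pi_addHom_ext fun i s α => ?_
      rw [AddMonoidHom.comp_apply, freeCompletionInv_single]
      funext j
      rw [freeCompletionHom_tmul, AddMonoidHom.id_apply]
      by_cases h : j = i
      · subst h; rw [Pi.single_eq_same, Pi.single_eq_same, toHat_pdPow]
      · rw [Pi.single_eq_of_ne h, Pi.single_eq_of_ne h, map_zero, mul_zero])

lemma freeCompletionEquiv_tmul (b : ℕ) (s : Series k n) (a : Fin b → D k n) (i : Fin b) :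
    freeCompletionEquiv k n b (Completion.tmul k n s a) i =
      (DiffOp.ofFun s : DHat k n) * toHat k n (a i) := rfl

/-- The completion of a matrix over `𝒟` is the same matrix, regarded over `𝒟̂`. -/
lemma freeCompletionEquiv_map {b c : ℕ} (v : Fin b → Fin c → D k n)
    (z : Completion k n (Fin b → D k n)) :
    Fintype.linearCombination (DHat k n) (fun i j => toHat k n (v i j))
      (freeCompletionEquiv k n b z) =
    freeCompletionEquiv k n c
      (Completion.map k n (Fintype.linearCombination (D k n) v) z) := by
  have : (Fintype.linearCombination (DHat k n) (fun i j => toHat k n (v i j))).toAddMonoidHom.comp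
      (freeCompletionEquiv k n b).toAddMonoidHom = (freeCompletionEquiv k n c).toAddMonoidHom.comp
      (Completion.map k n (Fintype.linearCombination (D k n) v)) := by
    refine Completion.addHom_ext k n fun s a => funext fun j => ?_
    change Fintype.linearCombination (DHat k n) (fun i j => toHat k n (v i j))
      (freeCompletionEquiv k n b (Completion.tmul k n s a)) j =
      freeCompletionEquiv k n c (Completion.tmul k n s (Fintype.linearCombination (D k n) v a)) j
    rw [freeCompletionEquiv_tmul, Fintype.linearCombination_apply, Fintype.linearCombination_apply,
      Finset.sum_apply, Finset.sum_apply, map_sum, Finset.mul_sum]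
    refine Finset.sum_congr rfl fun i _ => ?_
    rw [Pi.smul_apply, Pi.smul_apply, freeCompletionEquiv_tmul, smul_eq_mul, smul_eq_mul, map_mul,
      mul_assoc]
  exact DFunLike.congr_fun this z

variable {M : Type u} [AddCommGroup M] [Module (D k n) M]

/-- Identifies the completed augmentation with the `𝒟̂`-linear map sending `eᵢ` to `1 ⊗ wᵢ`. It
rests on `s ⊗ m = s (1 ⊗ m)` and on the semilinearity of `Completion.kappa`. -/
lemma freeCompletionEquiv_augmentation {b : ℕ} (w : Fin b → M)
    (z : Completion k n (Fin b → D k n)) :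
    Fintype.linearCombination (DHat k n) (fun i => Completion.kappa k n (w i))
      (freeCompletionEquiv k n b z) =
    Completion.map k n (Fintype.linearCombination (D k n) w) z := by
  have : (Fintype.linearCombination (DHat k n)
        (fun i => Completion.kappa k n (w i))).toAddMonoidHom.comp
      (freeCompletionEquiv k n b).toAddMonoidHom =
      Completion.map k n (Fintype.linearCombination (D k n) w) := by
    refine Completion.addHom_ext k n fun s a => ?_
    change Fintype.linearCombination (DHat k n) (fun i => Completion.kappa k n (w i))
      (freeCompletionEquiv k n b (Completion.tmul k n s a)) =
      Completion.tmul k n s (Fintype.linearCombination (D k n) w a)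
    have e : Completion.tmul k n s (Fintype.linearCombination (D k n) w a) =
        (DiffOp.ofFun s : DHat k n) •
          Completion.kappa k n (Fintype.linearCombination (D k n) w a) := by
      rw [Completion.ofFun_smul]
      change _ = s • Completion.tmul k n 1 _
      rw [Completion.smul_tmul, mul_one]
    rw [e, Fintype.linearCombination_apply, Fintype.linearCombination_apply, map_sum,
      Finset.smul_sum]
    refine Finset.sum_congr rfl fun i _ => ?_
    rw [freeCompletionEquiv_tmul, mul_smul, map_smulₛₗ]
  exact DFunLike.congr_fun this z

/-- Flatness of `R̂` over `R`, transported along `freeCompletionEquiv`. -/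
lemma exact_hat {b c d : ℕ} {v : Fin b → Fin c → D k n} {w : Fin c → Fin d → D k n}
    (h : Function.Exact (Fintype.linearCombination (D k n) v)
      (Fintype.linearCombination (D k n) w)) :
    Function.Exact (Fintype.linearCombination (DHat k n) (fun i j => toHat k n (v i j)))
      (Fintype.linearCombination (DHat k n) (fun i j => toHat k n (w i j))) := by
  intro y
  obtain ⟨y, rfl⟩ := (freeCompletionEquiv k n c).surjective y
  rw [freeCompletionEquiv_map, EmbeddingLike.map_eq_zero_iff, Completion.map_exact k n h y]
  constructor
  · rintro ⟨x, rfl⟩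
    exact ⟨_, freeCompletionEquiv_map v x⟩
  · rintro ⟨x, hx⟩
    obtain ⟨x, rfl⟩ := (freeCompletionEquiv k n b).surjective x
    rw [freeCompletionEquiv_map] at hx
    exact ⟨x, (freeCompletionEquiv k n c).injective hx⟩

lemma exact_hat_augmentation {b c : ℕ} {v : Fin b → Fin c → D k n} {w : Fin c → M}
    (h : Function.Exact (Fintype.linearCombination (D k n) v)
      (Fintype.linearCombination (D k n) w)) :
    Function.Exact (Fintype.linearCombination (DHat k n) (fun i j => toHat k n (v i j)))
      (Fintype.linearCombination (DHat k n) (fun i => Completion.kappa k n (w i))) := by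
  intro y
  obtain ⟨y, rfl⟩ := (freeCompletionEquiv k n c).surjective y
  rw [freeCompletionEquiv_augmentation, Completion.map_exact k n h y]
  constructor
  · rintro ⟨x, rfl⟩
    exact ⟨_, freeCompletionEquiv_map v x⟩
  · rintro ⟨x, hx⟩
    obtain ⟨x, rfl⟩ := (freeCompletionEquiv k n b).surjective x
    rw [freeCompletionEquiv_map] at hx
    exact ⟨x, (freeCompletionEquiv k n c).injective hx⟩

lemma surjective_hat_augmentation {b : ℕ} {w : Fin b → M}
    (h : Function.Surjective (Fintype.linearCombination (D k n) w)) :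
    Function.Surjective
      (Fintype.linearCombination (DHat k n) (fun i => Completion.kappa k n (w i))) := by
  intro y
  obtain ⟨x, rfl⟩ := Completion.map_surjective k n h y
  exact ⟨_, freeCompletionEquiv_augmentation w x⟩

end FreeCompletion

end

end DMod

namespace DMod

noncomputable section

set_option linter.unusedSectionVars false

/-! ### Left Noetherianity of `𝒟` by leading symbols. -/

section Noetherian

variable {k : Type u} [Field k] [CharZero k] {n : ℕ}

variable (k n) in
/-- The full symbol `∑ f_α ∂ ^ α ↦ ∑ f_α ξ ^ α`. -/
def symbol : D k n →+ MvPolynomial (Fin n) (Poly k n) :=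
  normalHom fun α => (MvPolynomial.monomial α).toAddMonoidHom

lemma symbol_normal (a : Poly k n) (α : Fin n →₀ ℕ) :
    symbol k n (DiffOp.ofFun a * pdPow k (Poly k n) α) = MvPolynomial.monomial α a :=
  normalHom_apply _ a α

lemma diffOp_induction {A : Type u} [CommRing A] [Algebra k A] [Coordinates k A n]
    {p : DiffOp k A → Prop} (zero : p 0) (add : ∀ P Q, p P → p Q → p (P + Q))
    (normal : ∀ (a : A) α, p (DiffOp.ofFun a * pdPow k A α)) (P : DiffOp k A) : p P := by
  obtain ⟨f, rfl⟩ := (normalEquiv (k := k) (A := A)).surjective P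
  induction f using Finsupp.induction_linear with
  | zero => rw [map_zero]; exact zero
  | add f g hf hg => rw [map_add]; exact add _ _ hf hg
  | single α a => rw [normalEquiv_single]; exact normal a α

lemma coeff_symbol (P : D k n) (α : Fin n →₀ ℕ) :
    (symbol k n P).coeff α = normalEquiv.symm P α := by
  classical
  induction P using diffOp_induction with
  | zero => rw [map_zero, map_zero]; rfl
  | add P Q hP hQ => rw [map_add, map_add, MvPolynomial.coeff_add, Finsupp.add_apply, hP, hQ]
  | normal a β =>
    rw [symbol_normal, ← normalEquiv_single, AddEquiv.symm_apply_apply,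
      MvPolynomial.coeff_monomial, Finsupp.single_apply]

lemma eq_zero_of_coeff_symbol {P : D k n} (h : ∀ α, (symbol k n P).coeff α = 0) : P = 0 := by
  rw [← map_eq_zero_iff _ (normalEquiv (k := k) (A := Poly k n)).symm.injective]
  ext1 α
  rw [← coeff_symbol, h]
  rfl

lemma symbol_ofFun_mul (r : Poly k n) (P : D k n) :
    symbol k n (DiffOp.ofFun r * P) = MvPolynomial.C r * symbol k n P := by
  induction P using diffOp_induction with
  | zero => rw [mul_zero, map_zero, mul_zero]
  | add P Q hP hQ => rw [mul_add, map_add, map_add, mul_add, hP, hQ]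
  | normal a α =>
    rw [← mul_assoc, ← map_mul, symbol_normal, symbol_normal, MvPolynomial.C_mul_monomial]

/-- From `∂ᵢ f = f ∂ᵢ + ∂ᵢ(f)`. The correction term does not raise the order, so on leading symbols
left multiplication by `∂ᵢ` is multiplication by `ξᵢ`. -/
lemma coeff_symbol_pd_mul (i : Fin n) (P : D k n) (β : Fin n →₀ ℕ) :
    (symbol k n (pd k (Poly k n) i * P)).coeff β =
      (MvPolynomial.X i * symbol k n P).coeff β +
        MvPolynomial.pderiv i ((symbol k n P).coeff β) := by
  classical
  induction P using diffOp_induction with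
  | zero => rw [mul_zero, map_zero, mul_zero, MvPolynomial.coeff_zero, map_zero, add_zero]
  | add P Q hP hQ =>
    rw [mul_add, map_add, map_add, mul_add, MvPolynomial.coeff_add, MvPolynomial.coeff_add,
      MvPolynomial.coeff_add, map_add, hP, hQ, add_add_add_comm]
  | normal a α =>
    rw [← mul_assoc, pd_mul_ofFun, add_mul, mul_assoc, ← pdPow_single_add, map_add, symbol_normal,
      symbol_normal, symbol_normal, MvPolynomial.coeff_add]
    congr 1
    · rw [MvPolynomial.X, MvPolynomial.monomial_mul, one_mul]
    · rw [MvPolynomial.coeff_monomial, MvPolynomial.coeff_monomial]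
      split_ifs
      · rfl
      · rw [map_zero]

lemma coeff_X_mul_eq_zero {i : Fin n} {g : MvPolynomial (Fin n) (Poly k n)} {β : Fin n →₀ ℕ}
    (h : ∀ γ, γ.degree + 1 = β.degree → g.coeff γ = 0) : (MvPolynomial.X i * g).coeff β = 0 := by
  classical
  rw [MvPolynomial.coeff_X_mul']
  split_ifs with hi
  · apply h
    have hle : Finsupp.single i 1 ≤ β := by
      rw [Finsupp.single_le_iff]
      have := Finsupp.mem_support_iff.1 hi
      omega
    have := congrArg Finsupp.degree (tsub_add_cancel_of_le hle)
    rwa [map_add, Finsupp.degree_single] at this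
  · rfl

/-- The polynomials all of whose homogeneous components are leading symbols of
operators in a left ideal. -/
def HasLifts (I : Submodule (D k n) (D k n)) (g : MvPolynomial (Fin n) (Poly k n)) : Prop :=
  ∀ m, ∃ Q ∈ I, (∀ β, m < β.degree → (symbol k n Q).coeff β = 0) ∧
    ∀ β, β.degree = m → (symbol k n Q).coeff β = g.coeff β

variable {I : Submodule (D k n) (D k n)}

lemma HasLifts.add {g h : MvPolynomial (Fin n) (Poly k n)} (hg : HasLifts I g)
    (hh : HasLifts I h) : HasLifts I (g + h) := by
  intro m
  obtain ⟨P, hP, hP1, hP2⟩ := hg m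
  obtain ⟨Q, hQ, hQ1, hQ2⟩ := hh m
  refine ⟨P + Q, add_mem hP hQ, fun β hβ => ?_, fun β hβ => ?_⟩
  · rw [map_add, MvPolynomial.coeff_add, hP1 β hβ, hQ1 β hβ, add_zero]
  · rw [map_add, MvPolynomial.coeff_add, MvPolynomial.coeff_add, hP2 β hβ, hQ2 β hβ]

/-- If `P` lifts the degree `m` component of `g`, then `∂ᵢ P` lifts the degree `m + 1` component of
`ξᵢ g`. In degree `0` that product has no component, and `0` is a lift. -/
lemma HasLifts.X_mul {g : MvPolynomial (Fin n) (Poly k n)} (hg : HasLifts I g) (i : Fin n) :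
    HasLifts I (MvPolynomial.X i * g) := by
  intro m
  cases m with
  | zero =>
    refine ⟨0, zero_mem _, fun β _ => by simp, fun β hβ => ?_⟩
    rw [map_zero, MvPolynomial.coeff_zero, coeff_X_mul_eq_zero]
    intro γ hγ; omega
  | succ m =>
    obtain ⟨P, hP, hP1, hP2⟩ := hg m
    refine ⟨pd k (Poly k n) i * P, I.smul_mem _ hP, fun β hβ => ?_, fun β hβ => ?_⟩
    · rw [coeff_symbol_pd_mul, hP1 β (by omega), map_zero, add_zero]
      exact coeff_X_mul_eq_zero fun γ hγ => hP1 γ (by omega)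
    · rw [coeff_symbol_pd_mul, hP1 β (by omega), map_zero, add_zero, ← sub_eq_zero,
        ← MvPolynomial.coeff_sub, ← mul_sub]
      refine coeff_X_mul_eq_zero fun γ hγ => ?_
      rw [MvPolynomial.coeff_sub, hP2 γ (by omega), sub_self]

lemma HasLifts.C_mul {g : MvPolynomial (Fin n) (Poly k n)} (hg : HasLifts I g) (r : Poly k n) :
    HasLifts I (MvPolynomial.C r * g) := by
  intro m
  obtain ⟨P, hP, hP1, hP2⟩ := hg m
  refine ⟨DiffOp.ofFun r * P, I.smul_mem _ hP, fun β hβ => ?_, fun β hβ => ?_⟩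
  · rw [symbol_ofFun_mul, MvPolynomial.coeff_C_mul, hP1 β hβ, mul_zero]
  · rw [symbol_ofFun_mul, MvPolynomial.coeff_C_mul, MvPolynomial.coeff_C_mul, hP2 β hβ]

/-- With `HasLifts.add` this shows that the liftable polynomials form an ideal, so liftability need
only be checked on ideal generators. -/
lemma HasLifts.mul (a : MvPolynomial (Fin n) (Poly k n)) {g : MvPolynomial (Fin n) (Poly k n)}
    (hg : HasLifts I g) : HasLifts I (a * g) := by
  induction a using MvPolynomial.induction_on generalizing g with
  | C r => exact hg.C_mul r
  | add p q hp hq => rw [add_mul]; exact (hp hg).add (hq hg)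
  | mul_X p i hp => rw [mul_assoc]; exact hp (hg.X_mul i)

/-- The ring of differential operators on a polynomial ring is left Noetherian. -/
instance isNoetherianRing_D : IsNoetherianRing (D k n) := by
  refine ⟨fun I => ?_⟩
  let G : Set (MvPolynomial (Fin n) (Poly k n)) := {g | ∃ m, ∃ P ∈ I,
    (∀ β, m < β.degree → (symbol k n P).coeff β = 0) ∧
      g = MvPolynomial.homogeneousComponent m (symbol k n P)}
  -- Hilbert's basis theorem for the ideal generated by the leading symbols of elements of `I`. Its
  -- finitely many generators may be chosen among these symbols, and operators of `I` lifting them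
  -- generate `I'`.
  have hfg : (Submodule.span (MvPolynomial (Fin n) (Poly k n)) G).FG := IsNoetherian.noetherian _
  obtain ⟨t, ht, hts⟩ := (Submodule.fg_span_iff_fg_span_finset_subset G).1 hfg
  choose m P hPI hP hg using fun g : t => ht g.2
  let I' : Submodule (D k n) (D k n) := Submodule.span (D k n) (Set.range P)
  have hI' : I' ≤ I := Submodule.span_le.2 (by rintro _ ⟨g, rfl⟩; exact hPI g)
  have hlift : ∀ g ∈ Submodule.span (MvPolynomial (Fin n) (Poly k n)) G, HasLifts I' g := by
    intro g hgG
    rw [hts] at hgG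
    induction hgG using Submodule.span_induction with
    | mem g hgt =>
      intro j
      have hg' := fun β => congrArg (MvPolynomial.coeff β) (hg ⟨g, hgt⟩)
      simp only [MvPolynomial.coeff_homogeneousComponent] at hg'
      by_cases hj : j = m ⟨g, hgt⟩
      · subst hj
        refine ⟨P ⟨g, hgt⟩, Submodule.subset_span ⟨_, rfl⟩, hP _, fun β hβ => ?_⟩
        exact ((hg' β).trans (if_pos hβ)).symm
      · refine ⟨0, zero_mem _, fun β _ => by simp, fun β hβ => ?_⟩
        rw [map_zero, MvPolynomial.coeff_zero]
        exact ((hg' β).trans (if_neg (by omega))).symm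
    | zero => exact fun j => ⟨0, zero_mem _, fun β _ => by simp, fun β _ => by simp⟩
    | add g h _ _ hg hh => exact hg.add hh
    | smul a g _ hg => exact hg.mul a
  -- Induction on the order: subtracting an element of `I'` with the same leading symbol lowers the
  -- order, and in order `0` leaves nothing.
  have key : ∀ j, ∀ Q ∈ I, (∀ β, j < β.degree → (symbol k n Q).coeff β = 0) → Q ∈ I' := by
    intro j
    induction j with
    | zero =>
      intro Q hQ hQ0
      obtain ⟨Q', hQ', h1, h2⟩ := hlift _ (Submodule.subset_span ⟨0, Q, hQ, hQ0, rfl⟩) 0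
      have : Q - Q' = 0 := eq_zero_of_coeff_symbol fun β => by
        rw [map_sub, MvPolynomial.coeff_sub]
        by_cases hβ : β.degree = 0
        · rw [h2 β hβ, MvPolynomial.coeff_homogeneousComponent, if_pos hβ, sub_self]
        · rw [hQ0 β (by omega), h1 β (by omega), sub_self]
      rw [sub_eq_zero.1 this]; exact hQ'
    | succ j ih =>
      intro Q hQ hQ0
      obtain ⟨Q', hQ', h1, h2⟩ := hlift _ (Submodule.subset_span ⟨j + 1, Q, hQ, hQ0, rfl⟩) (j + 1)
      rw [← sub_add_cancel Q Q']
      refine add_mem (ih _ (sub_mem hQ (hI' hQ')) fun β hβ => ?_) hQ'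
      rw [map_sub, MvPolynomial.coeff_sub]
      by_cases hβ' : β.degree = j + 1
      · rw [h2 β hβ', MvPolynomial.coeff_homogeneousComponent, if_pos hβ', sub_self]
      · rw [hQ0 β (by omega), h1 β (by omega), sub_self]
  have hI : I = I' := le_antisymm (fun Q hQ => by
    refine key (symbol k n Q).totalDegree Q hQ fun β hβ => ?_
    exact MvPolynomial.coeff_eq_zero_of_totalDegree_lt hβ) hI'
  rw [hI]
  exact Submodule.fg_span (Set.finite_range P)

end Noetherian

end

end DMod

namespace DMod

noncomputable section

set_option linter.unusedSectionVars false

open CategoryTheory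

/-! ### Complexes of free modules, tensored and written in coordinates. -/

section FreeComplex

variable {A : Type u} [Ring A] {b : ℕ → ℕ} (v : ∀ j, Fin (b (j + 1)) → Fin (b j) → A)
  (hv : ∀ j, Function.Exact (Fintype.linearCombination A (v (j + 1)))
    (Fintype.linearCombination A (v j)))

/-- The complex of free modules given by a sequence of matrices. -/
abbrev freeComplex : ChainComplex (ModuleCat.{u} A) ℕ :=
  exactComplex (X := fun j => Fin (b j) → A) (fun j => Fintype.linearCombination A (v j)) hv

variable {k : Type u} [Field k] {N : Type u} [AddCommGroup N] [Module k N] [Module Aᵐᵒᵖ N]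
  [SMulCommClass k Aᵐᵒᵖ N]

variable (k N) in
/-- The complex `N ⊗_A A^{b_•}`. -/
abbrev freeTensorComplex : ChainComplex (ModuleCat.{u} k) ℕ :=
  ((tensorFunctor k A N).mapHomologicalComplex _).obj (freeComplex v hv)

variable (k N) in
/-- Coordinates on the complex `N ⊗_A A^{b_•}`. -/
def freeTensorCoord (j : ℕ) : (freeTensorComplex v hv k N).X j ≃ₗ[k] (Fin (b j) → N) :=
  freeTensorEquiv k A N (b j)

lemma freeTensorCoord_d (j : ℕ) (z : (freeTensorComplex v hv k N).X (j + 1)) (i : Fin (b j)) :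
    freeTensorCoord v hv k N j ((freeTensorComplex v hv k N).d (j + 1) j z) i =
      ∑ i', MulOpposite.op (v j i' i) • freeTensorCoord v hv k N (j + 1) z i' := by
  have h : (freeTensorComplex v hv k N).d (j + 1) j =
      (tensorFunctor k A N).map (ModuleCat.ofHom (Fintype.linearCombination A (v j))) :=
    congrArg (tensorFunctor k A N).map (exactComplex_d _ hv j)
  rw [h]
  exact freeTensorEquiv_map (v j) z i

end FreeComplex

/-! ### The two tensored complexes compared coordinatewise. -/

section Compare

variable {k A B : Type u} [Field k] [Ring A] [Ring B] (ρ : A →+* B)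
  {N N' : Type u} [AddCommGroup N] [Module k N] [Module Aᵐᵒᵖ N] [SMulCommClass k Aᵐᵒᵖ N]
  [AddCommGroup N'] [Module k N'] [Module Bᵐᵒᵖ N'] [SMulCommClass k Bᵐᵒᵖ N']
  {b : ℕ → ℕ} (v : ∀ j, Fin (b (j + 1)) → Fin (b j) → A)
  (hv : ∀ j, Function.Exact (Fintype.linearCombination A (v (j + 1)))
    (Fintype.linearCombination A (v j)))
  (hv' : ∀ j, Function.Exact (Fintype.linearCombination B fun i l => ρ (v (j + 1) i l))
    (Fintype.linearCombination B fun i l => ρ (v j i l)))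

/-- The map `A^b → B^b` induced by `ρ`, as an `A`-linear map. -/
def freeRestrictHom (c : ℕ) : ModuleCat.of A (Fin c → A) ⟶
    (ModuleCat.restrictScalars ρ).obj (ModuleCat.of B (Fin c → B)) :=
  semilinearHom ρ
    { toFun := fun a i => ρ (a i)
      map_add' := fun _ _ => funext fun _ => map_add ρ _ _
      map_smul' := fun _ _ => funext fun _ => map_mul ρ _ _ }

lemma linearCombination_semilinear {M M' : Type u} [AddCommGroup M] [Module A M] [AddCommGroup M']
    [Module B M'] (f : M →ₛₗ[ρ] M') {c : ℕ} (w : Fin c → M) (a : Fin c → A) :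
    Fintype.linearCombination B (fun i => f (w i)) (fun i => ρ (a i)) =
      f (Fintype.linearCombination A w a) := by
  rw [Fintype.linearCombination_apply, Fintype.linearCombination_apply, map_sum]
  exact Finset.sum_congr rfl fun i _ => (map_smulₛₗ _ _ _).symm

lemma linearCombination_map {c d : ℕ} (w : Fin c → Fin d → A) (a : Fin c → A) (i : Fin d) :
    Fintype.linearCombination B (fun i l => ρ (w i l)) (fun i => ρ (a i)) i =
      ρ (Fintype.linearCombination A w a i) := by
  simp [Fintype.linearCombination_apply, Finset.sum_apply]

/-- The chain map `A^{b_•} → B^{b_•}` induced by `ρ`. -/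
def freeComplexMap : freeComplex v hv ⟶
    restrictComplex ρ (freeComplex (fun j i l => ρ (v j i l)) hv') where
  f j := freeRestrictHom ρ (b j)
  comm' i j h := by
    obtain rfl : j + 1 = i := h
    have h1 := exactComplex_d (X := fun j => Fin (b j) → A)
      (fun j => Fintype.linearCombination A (v j)) hv j
    have h2 : (restrictComplex ρ (freeComplex (fun j i l => ρ (v j i l)) hv')).d (j + 1) j =
        (ModuleCat.restrictScalars ρ).map
          (ModuleCat.ofHom (Fintype.linearCombination B fun i l => ρ (v j i l))) :=
      congrArg (ModuleCat.restrictScalars ρ).map (exactComplex_d _ hv' j)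
    rw [h1, h2]
    refine ModuleCat.hom_ext (LinearMap.ext fun a => funext fun i => ?_)
    exact linearCombination_map ρ (v j) a i

variable (g : N →ₗ[k] N')
  (hg : ∀ (a : A) (x : N), g (MulOpposite.op a • x) = MulOpposite.op (ρ a) • g x)

lemma freeTensorCoord_tensorChainMap (j : ℕ) (z : (freeTensorComplex v hv k N).X j)
    (i : Fin (b j)) :
    freeTensorCoord (fun j i l => ρ (v j i l)) hv' k N' j
      ((tensorChainMap ρ g hg (freeComplexMap ρ v hv hv')).f j z) i =
      g (freeTensorCoord v hv k N j z i) := by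
  let F : BalancedTensor k A N (Fin (b j) → A) →ₗ[k] N' :=
    LinearMap.proj i ∘ₗ (freeTensorCoord (fun j i l => ρ (v j i l)) hv' k N' j).toLinearMap ∘ₗ
      ((tensorChainMap ρ g hg (freeComplexMap ρ v hv hv')).f j).hom
  let G : BalancedTensor k A N (Fin (b j) → A) →ₗ[k] N' :=
    g ∘ₗ LinearMap.proj i ∘ₗ (freeTensorCoord v hv k N j).toLinearMap
  have : F = G := by
    refine BalancedTensor.hom_ext fun x a => ?_
    change MulOpposite.op (ρ (a i)) • g x = g (MulOpposite.op (a i) • x)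
    exact (hg _ _).symm
  exact LinearMap.congr_fun this z

/-- The chain map `N' ⊗_B B^{b_•} → N ⊗_A A^{b_•}` given by maps `N' → N` on coordinates. -/
def coordChainMap (p : ∀ j, Fin (b j) → (N' →ₗ[k] N))
    (hp : ∀ j i i' s, p j i (MulOpposite.op (ρ (v j i' i)) • s) =
      MulOpposite.op (v j i' i) • p (j + 1) i' s) :
    freeTensorComplex (fun j i l => ρ (v j i l)) hv' k N' ⟶ freeTensorComplex v hv k N where
  f j := ModuleCat.ofHom ((freeTensorCoord v hv k N j).symm.toLinearMap ∘ₗ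
    LinearMap.pi (fun i => p j i ∘ₗ LinearMap.proj i) ∘ₗ
    (freeTensorCoord (fun j i l => ρ (v j i l)) hv' k N' j).toLinearMap)
  comm' i j h := by
    obtain rfl : j + 1 = i := h
    refine ModuleCat.hom_ext (LinearMap.ext fun z => ?_)
    apply (freeTensorCoord v hv k N j).injective
    funext i
    refine (freeTensorCoord_d v hv j _ i).trans ?_
    change _ = freeTensorCoord v hv k N j ((freeTensorCoord v hv k N j).symm
      fun i => p j i (freeTensorCoord (fun j i l => ρ (v j i l)) hv' k N' j
        ((freeTensorComplex (fun j i l => ρ (v j i l)) hv' k N').d (j + 1) j z) i)) i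
    rw [LinearEquiv.apply_symm_apply, freeTensorCoord_d, map_sum]
    refine Finset.sum_congr rfl fun i' _ => ?_
    -- The maps on coordinates commute with the differentials because they commute with each matrix
    -- entry separately.
    rw [hp]
    congr 1
    change freeTensorCoord v hv k N (j + 1) ((freeTensorCoord v hv k N (j + 1)).symm
      fun i => p (j + 1) i (freeTensorCoord (fun j i l => ρ (v j i l)) hv' k N' (j + 1) z i)) i' = _
    rw [LinearEquiv.apply_symm_apply]

lemma coord_coordChainMap (p : ∀ j, Fin (b j) → (N' →ₗ[k] N))
    (hp : ∀ j i i' s, p j i (MulOpposite.op (ρ (v j i' i)) • s) =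
      MulOpposite.op (v j i' i) • p (j + 1) i' s) (j : ℕ)
    (z : (freeTensorComplex (fun j i l => ρ (v j i l)) hv' k N').X j) (i : Fin (b j)) :
    freeTensorCoord v hv k N j ((coordChainMap ρ v hv hv' p hp).f j z) i =
      p j i (freeTensorCoord (fun j i l => ρ (v j i l)) hv' k N' j z i) := by
  change freeTensorCoord v hv k N j ((freeTensorCoord v hv k N j).symm
      fun i => p j i (freeTensorCoord (fun j i l => ρ (v j i l)) hv' k N' j z i)) i = _
  rw [LinearEquiv.apply_symm_apply]

/-- Each condition reduces to a single coordinate. The projections may depend on the coordinate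
because basis vectors have different degrees. -/
lemma isGradedCompletion_coord (p : ℤ → ∀ j, Fin (b j) → (N' →ₗ[k] N))
    (hp : ∀ l j i i' s, p l j i (MulOpposite.op (ρ (v j i' i)) • s) =
      MulOpposite.op (v j i' i) • p l (j + 1) i' s)
    (hsum : ∀ j i x, ∃ s : Finset ℤ, ∀ t, s ⊆ t → ∑ l ∈ t, p l j i (g x) = x)
    (hself : ∀ l j i y, p l j i (g (p l j i y)) = p l j i y)
    (hne : ∀ l m j i y, l ≠ m → p l j i (g (p m j i y)) = 0)
    (hprod : ∀ j i (x : ℤ → N), ∃ y : N', ∀ l, p l j i y = p l j i (g (x l)))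
    (hext : ∀ j i y, (∀ l, p l j i y = 0) → y = 0) :
    IsGradedCompletion (tensorChainMap (N := N) ρ g hg (freeComplexMap ρ v hv hv'))
      (fun l => coordChainMap ρ v hv hv' (p l) (hp l)) where
  sum j x := by
    choose s hs using fun i => hsum j i (freeTensorCoord v hv k N j x i)
    -- Finite rank is used here: the finite sets of degrees for the individual coordinates have a
    -- finite union.
    refine ⟨Finset.univ.biUnion s, fun t ht => (freeTensorCoord v hv k N j).injective ?_⟩
    funext i
    rw [map_sum, Finset.sum_apply]
    refine Eq.trans (Finset.sum_congr rfl fun l _ => ?_)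
      (hs i t ((Finset.subset_biUnion_of_mem s (Finset.mem_univ i)).trans ht))
    rw [coord_coordChainMap, freeTensorCoord_tensorChainMap]
  proj_self j l y := (freeTensorCoord v hv k N j).injective (funext fun i => by
    rw [coord_coordChainMap, freeTensorCoord_tensorChainMap, coord_coordChainMap, hself])
  proj_ne j l m y hlm := (freeTensorCoord v hv k N j).injective (funext fun i => by
    rw [coord_coordChainMap, freeTensorCoord_tensorChainMap, coord_coordChainMap,
      hne l m j i _ hlm, map_zero]
    rfl)
  prod j x := by
    choose y hy using fun i => hprod j i fun l => freeTensorCoord v hv k N j (x l) i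
    refine ⟨(freeTensorCoord (fun j i l => ρ (v j i l)) hv' k N' j).symm y, fun l =>
      (freeTensorCoord v hv k N j).injective (funext fun i => ?_)⟩
    rw [coord_coordChainMap, coord_coordChainMap, freeTensorCoord_tensorChainMap,
      LinearEquiv.apply_symm_apply, hy]
  ext j y h := (freeTensorCoord (fun j i l => ρ (v j i l)) hv' k N' j).injective
    (funext fun i => by
      rw [map_zero]
      refine hext j i _ fun l => ?_
      rw [← coord_coordChainMap (hv := hv) (hp := hp l), h l, map_zero]
      rfl)

end Compare

/-! ### The natural map on Tor for graded modules. -/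

section Main

variable {k : Type u} [Field k] [CharZero k] {n : ℕ}

theorem iota_injective_and_bijective
    {M : Type u} [AddCommGroup M] [Module (D k n) M] [Module.Finite (D k n) M]
    {ℳ : ℤ → AddSubgroup M} (hℳ : IsGradedDModule k n ℳ) (j : ℕ) :
    Function.Injective (iota k n M j) ∧
      (FiniteDimensional k (Tor k (D k n) (Transpose (Poly k n)) j M) →
        Function.Bijective (iota k n M j)) := by
  obtain ⟨b, deg, v, w, hdeg, hv, hw, hs⟩ := exists_graded_resolution hℳ
  have hv' : ∀ j, Function.Exact
      (Fintype.linearCombination (DHat k n) fun i l => toHat k n (v (j + 1) i l))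
      (Fintype.linearCombination (DHat k n) fun i l => toHat k n (v j i l)) :=
    fun j => exact_hat (hv j)
  let P := exactResolution (X := fun j => Fin (b j) → D k n)
    (fun j => Fintype.linearCombination (D k n) (v j)) hv _ hw hs
  let Q := exactResolution (X := fun j => Fin (b j) → DHat k n)
    (fun j => Fintype.linearCombination (DHat k n) fun i l => toHat k n (v j i l)) hv' _
    (exact_hat_augmentation hw) (surjective_hat_augmentation hs)
  let φ : P.complex ⟶ restrictComplex (toHat k n) Q.complex :=
    freeComplexMap (toHat k n) v hv hv'
  -- The entrywise inclusion lifts `M → M̂`, since the augmentation of `Q` has values `1 ⊗ wᵢ` on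
  -- the basis.
  have hφ : φ.f 0 ≫ restrictAugmentation (toHat k n) Q =
      augmentation P ≫ semilinearHom (toHat k n) (Completion.kappa k n) := by
    refine ModuleCat.hom_ext (LinearMap.ext fun a => ?_)
    refine (augmentation_exactResolution (X := fun j => Fin (b j) → DHat k n) _ hv' _
      (exact_hat_augmentation hw) (surjective_hat_augmentation hs)
      (fun i => toHat k n (a i))).trans ?_
    have h := augmentation_exactResolution (X := fun j => Fin (b j) → D k n) _ hv _ hw hs a
    refine Eq.trans ?_ (congrArg (Completion.kappa k n) h.symm)
    exact linearCombination_semilinear (toHat k n) (Completion.kappa k n) w a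
  have hp : ∀ (l : ℤ) (j : ℕ) (i : Fin (b j)) (i' : Fin (b (j + 1)))
      (s : Transpose (Series k n)),
      hcompT k n (l - deg j i) (MulOpposite.op (toHat k n (v j i' i)) • s) =
        MulOpposite.op (v j i' i) • hcompT k n (l - deg (j + 1) i') s := by
    intro l j i i' s
    -- The entry `v j i' i` has degree `deg (j + 1) i' - deg j i`, exactly the difference between
    -- the two component indices.
    rw [← hcomp_op_smul (hdeg j i' i)]
    congr 2
    ring
  have key := isGradedCompletion_coord (toHat k n) v hv hv' (polyToSeries k n)
    (fun P => polyToSeries_smul k n (MulOpposite.op P))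
    (fun l j i => hcompT k n (l - deg j i)) hp
    (by
      intro j i x
      -- A monomial of degree `d` in coordinate `i` has total degree `d + deg j i`.
      refine ⟨(MvPolynomial.support (show Poly k n from x)).image
        fun d => (d.degree : ℤ) + deg j i, fun t ht => ?_⟩
      have h := sum_hcomp (show Poly k n from x) (t := t.image fun l => l - deg j i) (by
        intro d hd
        exact Finset.mem_image.2 ⟨_, ht (Finset.mem_image_of_mem _ hd), by ring⟩)
      rw [Finset.sum_image (fun a _ c _ h' => by simpa using h')] at h
      exact h)
    (fun l j i y => hcomp_hcomp_same _ _)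
    (fun l m j i y hlm => hcomp_hcomp_of_ne (by simpa using hlm) _)
    (by
      intro j i x
      obtain ⟨s, hs⟩ := exists_hcomp_eq (k := k) (n := n)
        fun l => polyToSeries k n (x (l + deg j i))
      refine ⟨s, fun l => (hs (l - deg j i)).trans ?_⟩
      rw [sub_add_cancel]
      rfl)
    (by
      intro j i y h
      refine hcomp_ext (k := k) (n := n) fun l => ?_
      have := h (l + deg j i)
      rw [add_sub_cancel_right] at this
      exact this)
  have e := torMap_eq (toHat k n) (polyToSeries k n)
    (fun P => polyToSeries_smul k n (MulOpposite.op P)) (Completion.kappa k n) P Q φ hφ j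
  let I := P.isoLeftDerivedObj (tensorFunctor k (D k n) (Transpose (Poly k n))) j
  let J := Q.isoLeftDerivedObj (tensorFunctor k (DHat k n) (Transpose (Series k n))) j
  have hI : Function.Bijective I.hom := (ConcreteCategory.isIso_iff_bijective I.hom).1 inferInstance
  have hJ : Function.Bijective J.inv := (ConcreteCategory.isIso_iff_bijective J.inv).1 inferInstance
  -- Up to the isomorphisms computing Tor by `P` and `Q`, `iota` is the homology map of the
  -- coordinatewise inclusion; finite-dimensionality is carried to the homology of the first complex
  -- along `I`.
  have e' : ⇑(iota k n M j) = J.inv ∘ (HomologicalComplex.homologyMap (tensorChainMap (toHat k n)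
      (polyToSeries k n) (fun P => polyToSeries_smul k n (MulOpposite.op P)) φ) j) ∘ I.hom := by
    rw [iota, e]
    rfl
  have hinj := hJ.1.comp ((key.homologyMap_injective j).comp hI.1)
  refine ⟨by rw [e']; exact hinj, fun hfin => ?_⟩
  rw [e']
  refine ⟨hinj, hJ.2.comp (Function.Surjective.comp ?_ hI.2)⟩
  have : FiniteDimensional k
      ((freeTensorComplex v hv k (Transpose (Poly k n))).homology j) :=
    LinearEquiv.finiteDimensional I.toLinearEquiv
  exact key.homologyMap_surjective j

end Main

end

end DMod

theorem mainTheorem4 (k : Type u) [Field k] [CharZero k] (n : ℕ)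
    (M : Type u) [AddCommGroup M] [Module (DMod.D k n) M] [Module.Finite (DMod.D k n) M]
    (ℳ : ℤ → AddSubgroup M) (hℳ : DMod.IsGradedDModule k n ℳ) :
    (∀ j : ℕ, Function.Injective (DMod.iota k n M j)) ∧
      ∀ j : ℕ, FiniteDimensional k
          (DMod.Tor k (DMod.D k n) (DMod.Transpose (DMod.Poly k n)) j M) →
        Function.Bijective (DMod.iota k n M j) :=
  ⟨fun j => (DMod.iota_injective_and_bijective hℳ j).1,
    fun j => (DMod.iota_injective_and_bijective hℳ j).2⟩
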